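/- \textbf{Setting.} An instance $J=(X,k,\mathcal R)$ of constrained binary $k$-means consists of $n\ge 1$ points $X=(x_1,\dots,x_n)$ in $\{0,1\}^d$, an integer $k\ge 1$, and nonempty relations $R_1,\dots,R_d\subseteq\{0,1\}^k$. Centers $C=(c_1,\dots,c_k)$ in $\{0,1\}^d$ satisfy $\mathcal R$ if $(c_1[i],\dots,c_k[i])\in R_i$ for every $i$. With $\mathcal H$ the Hamming distance (equal to the squared Euclidean distance on $\{0,1\}^d$), let $\Phi(C,X)=\sum_{x\in X}\min_j\mathcal H(x,c_j)$, and let $OPT$ be the minimum of $\Phi(C,X)$ over all $C$ satisfying $\mathcal R$. A list $B$ of $k$ centers is an $\alpha$-approximate solution of the unconstrained instance $(X,k)$ if $\Phi(B,X)\le\alpha\min_{C}\Phi(C,X)$, the minimum being over all lists $C$ of $k$ centers in $\{0,1\}^d$. \textbf{Algorithm} $\mathrm{GoodCenters}(J,B,\varepsilon)$, with integer parameters $\tau,\eta,\zeta$. Repeat the following $\zeta$ times independently. Draw $\eta k$ points of $X$ independently, each $x_i$ with probability proportional to $\min_{b\in B}\mathcal H(x_i,b)$ (uniformly if all these distances are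 $0$); let $M$ be the multiset of these points together with $\tau k$ copies of each of the $k$ centers in $B$. For all pairwise disjoint sub-multisets $S_1,\dots,S_k$ of $M$ of size $\tau$ each, and all $w_1,\dots,w_k\in\{1,(1+\frac\varepsilon2),\dots,(1+\frac\varepsilon2)^{\lceil\log_{1+\varepsilon/2}n\rceil}\}$, add to a collection $\mathcal C$ the centers $\mathrm{best}_{\mathcal R}(J,S_1,\dots,S_k,w_1,\dots,w_k)$ whose $i$-th coordinates form, for each $i\le d$, a tuple $(b_1,\dots,b_k)\in R_i$ minimizing $\sum_j w_j\cdot|\{s\in S_j: s[i]\ne b_j\}|$. Finally return a member of $\mathcal C$ of least cost $\Phi(\cdot,X)$. \textbf{Theorem.} There is a universal constant $c_0>0$ such that for all constants $c_1$ and $\alpha\ge 1$ there are constants $A,a$ with the following property. Let $0<\varepsilon\le\frac12$, let $J=(X,k,\mathcal R)$ be an instance as above, let $B$ be an $\alpha$-approximate solution of the unconstrained instance $(X,k)$, and let $\tau,\eta,\zeta$ be integers with $$c_0\tfrac{k}{\varepsilon^2}\log\tfrac k\varepsilon\le\tau\le c_1\tfrac{k}{\varepsilon^2}\log\tfrac k\varepsilon,\qquad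 c_0\tfrac{\tau\alpha k}{\varepsilon^2}\le\eta\le c_1\tfrac{\tau\alpha k}{\varepsilon^2},\qquad \tfrac{c_0}{\varepsilon}\le\zeta\le\tfrac{c_1}{\varepsilon}.$$ Then: 1. $\mathrm{GoodCenters}(J,B,\varepsilon)$ always returns a list $D$ of $k$ centers satisfying $\mathcal R$. 2. If some optimal center list of $J$ induces a clustering of $X$ (every point being assigned to a nearest center) in which none of the $k$ clusters is empty, then $\Pr[\Phi(D,X)\le(1+\varepsilon)\,OPT]\ge\frac34$. 3. If $d\ge1$ and $n\ge2$, the running time is always at most $A\cdot nd\,(\log n)^k\,2^{A\frac{k^2}{\varepsilon^2}\left(\log\frac{k^2}{\varepsilon^2}\right)^a}$, that is, $O\big(nd\,(\log n)^k\,2^{\tilde O(k^2/\varepsilon^2)}\big)$, where an arithmetic operation, a comparison, an access to an array cell and the bookkeeping of a loop iteration take constant time, and one weighted draw of a point takes time $O(n)$. If the number $0$ is added to the list of guesses for the $w_j$, then 1 and 3 still hold, and the bound in 2 holds for every instance, without the assumption on nonempty clusters. -/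

import Mathlib

open scoped ENNReal

noncomputable section

namespace BinaryKMeans

/-! ### The constrained binary k-means problem -/

/-- A point of the cube: a string of `d` bits. -/
abbrev Point (d : ℕ) := Fin d → Bool

/-- A list `(c_1, ..., c_k)` of `k` binary centers. -/
abbrev Centers (k d : ℕ) := Fin k → Point d

/-- The k-means cost: every point pays its distance to the nearest center. On bit strings the
squared Euclidean distance is the Hamming distance. -/
def cost {n d k : ℕ} (C : Centers k d) (X : Fin n → Point d) : ℕ :=
  ∑ i, ⨅ j, hammingDist (X i) (C j)

/-- An instance: `n` points in dimension `d` (repetitions are allowed), and for every coordinate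
a `k`-ary relation on bits. -/
structure ConstrainedInstance (n d k : ℕ) where
  points : Fin n → Point d
  rel : Fin d → Finset (Fin k → Bool)

/-- The centers satisfy the relations: in every coordinate `i`, the tuple of the `i`-th bits of
the `k` centers lies in the `i`-th relation. -/
def ConstrainedInstance.Satisfies {n d k : ℕ} (J : ConstrainedInstance n d k)
    (C : Centers k d) : Prop :=
  ∀ i, (fun j => C j i) ∈ J.rel i

/-- The least cost of a center list that satisfies the relations. -/
def ConstrainedInstance.opt {n d k : ℕ} (J : ConstrainedInstance n d k) : ℕ :=
  sInf {v | ∃ C : Centers k d, J.Satisfies C ∧ cost C J.points = v}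

/-- The same points without any constraint. -/
def unconstrained {n d : ℕ} (k : ℕ) (X : Fin n → Point d) : ConstrainedInstance n d k :=
  ⟨X, fun _ => Finset.univ⟩

/-- `B` is an `α`-approximate solution of the unconstrained binary k-means problem on `X`. -/
def IsApproxSolution {n d k : ℕ} (α : ℝ) (X : Fin n → Point d) (B : Centers k d) : Prop :=
  (cost B X : ℝ) ≤ α * ((unconstrained k X).opt : ℝ)

/-- Some optimal center list of the instance induces a clustering (every point goes to a nearest
center) in which none of the `k` clusters is empty. -/
def ConstrainedInstance.HasFullOptimum {n d k : ℕ} (J : ConstrainedInstance n d k) : Prop :=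
  ∃ C : Centers k d, J.Satisfies C ∧ cost C J.points = J.opt ∧
    ∃ a : Fin n → Fin k, Function.Surjective a ∧
      ∀ i j, hammingDist (J.points i) (C (a i)) ≤ hammingDist (J.points i) (C j)

/-! ### Computations with a step count

The model is the usual unit-cost one: arithmetic on numbers, a comparison, an access to an array
cell and the bookkeeping of one loop iteration take one step each. Arrays are functions on
`Fin m`; they are only produced cell by cell. -/

/-- A result together with the number of steps spent on it. -/
structure Timed (α : Type) where
  val : α
  steps : ℕ

namespace Timed

instance : Monad Timed where
  pure a := ⟨a, 0⟩
  bind x f := ⟨(f x.val).val, x.steps + (f x.val).steps⟩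

/-- One elementary operation with result `a`. -/
def op {α : Type} (a : α) : Timed α := ⟨a, 1⟩

/-- Fill an array of length `m`: one iteration and one write per cell. -/
def fill {m : ℕ} {α : Type} (f : Fin m → Timed α) : Timed (Fin m → α) :=
  ⟨fun i => (f i).val, 1 + ∑ i, ((f i).steps + 2)⟩

/-- Add up `m` computed values: one iteration and one addition per value. -/
def sumLoop {m : ℕ} {α : Type} [AddCommMonoid α] (f : Fin m → Timed α) : Timed α :=
  ⟨∑ i, (f i).val, 1 + ∑ i, ((f i).steps + 2)⟩

/-- Minimum of `m` computed values: one iteration, one comparison, one assignment per value. -/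
def minLoop {m : ℕ} (f : Fin m → Timed ℕ) : Timed ℕ :=
  ⟨⨅ i, (f i).val, 1 + ∑ i, ((f i).steps + 3)⟩

/-- Conjunction of `m` computed tests. -/
def allLoop {m : ℕ} (f : Fin m → Timed Bool) : Timed Bool :=
  ⟨decide (∀ i, (f i).val = true), 1 + ∑ i, ((f i).steps + 2)⟩

/-- Apply `f` to every entry of a list and collect the results. -/
def collect {α β : Type} (f : α → Timed β) (l : List α) : Timed (List β) :=
  ⟨l.map fun a => (f a).val, 1 + (l.map fun a => (f a).steps + 2).sum⟩

/-- Apply a list-valued `f` to every entry of a list and concatenate (copying) the results. -/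
def collectMany {α β : Type} (f : α → Timed (List β)) (l : List α) : Timed (List β) :=
  ⟨l.flatMap fun a => (f a).val, 1 + (l.map fun a => (f a).steps + (f a).val.length + 2).sum⟩

/-- The entries of a list that pass a test. -/
def select {α : Type} (f : α → Timed Bool) (l : List α) : Timed (List α) :=
  ⟨l.filter fun a => (f a).val, 1 + (l.map fun a => (f a).steps + 2).sum⟩

/-- The first entry of a list at which the computed value is least (`none` for the empty list):
per entry one iteration, one evaluation, one comparison, one assignment. -/
def argminLoop {α β : Type} [LinearOrder β] (f : α → Timed β) (l : List α) : Timed (Option α) :=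
  ⟨l.argmin fun a => (f a).val, 1 + (l.map fun a => (f a).steps + 3).sum⟩

/-- All `m`-tuples over a list, by recursion on `m`; writing out a tuple costs its length. -/
def tuples {α : Type} : (m : ℕ) → List α → Timed (List (Fin m → α))
  | 0, _ => op [Fin.elim0]
  | m + 1, l => do
      let ts ← tuples m l
      collectMany (fun a => collect (fun t => ⟨Fin.cons (α := fun _ => α) a t, m + 1⟩) ts) l

end Timed

/-- A randomized computation: the joint law of its result and of its number of steps. -/
structure Rand (α : Type) where
  law : PMF (Timed α)

namespace Rand

instance : Monad Rand where
  pure a := ⟨PMF.pure ⟨a, 0⟩⟩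
  bind p f := ⟨p.law.bind fun x =>
    (f x.val).law.map fun y => ⟨y.val, x.steps + y.steps⟩⟩

/-- A deterministic computation. -/
def lift {α : Type} (x : Timed α) : Rand α := ⟨PMF.pure x⟩

/-- `m` independent runs, the results being stored in an array. -/
def replicate {α : Type} : (m : ℕ) → Rand α → Rand (Fin m → α)
  | 0, _ => lift (Timed.op Fin.elim0)
  | m + 1, p => do
      let a ← p
      let t ← replicate m p
      lift ⟨Fin.cons (α := fun _ => α) a t, 2⟩

end Rand

/-! ### The algorithm -/

/-- Hamming distance, bit by bit. -/
def distLoop {d : ℕ} (x y : Point d) : Timed ℕ :=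
  Timed.sumLoop fun i => do
    let a ← Timed.op (x i)
    let b ← Timed.op (y i)
    Timed.op (if a ≠ b then 1 else 0)

/-- Distance of a point to the nearest center of a list. -/
def nearestLoop {d k : ℕ} (C : Centers k d) (x : Point d) : Timed ℕ :=
  Timed.minLoop fun j => distLoop x (C j)

/-- The k-means cost, computed. -/
def costLoop {n d k : ℕ} (C : Centers k d) (X : Fin n → Point d) : Timed ℕ :=
  Timed.sumLoop fun i => nearestLoop C (X i)

/-- The law on indices that is proportional to the weights `D`. If all weights vanish, this is
undefined, and an index is drawn uniformly instead. -/
def weightedLaw {n : ℕ} [NeZero n] (D : Fin n → ℕ) : PMF (Fin n) :=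
  if h : ∑ i, (D i : ℝ≥0∞) = 0 then PMF.uniformOfFintype (Fin n)
  else PMF.normalize (fun i => (D i : ℝ≥0∞))
    (by rwa [tsum_fintype])
    (by rw [tsum_fintype]; exact ENNReal.sum_ne_top.2 fun i _ => ENNReal.natCast_ne_top (D i))

/-- One draw from the array of weights: one random number and one scan of the running totals
(iteration, addition, comparison for each entry). -/
def weightedDraw {n : ℕ} [NeZero n] (D : Fin n → ℕ) : Rand (Fin n) :=
  ⟨(weightedLaw D).map fun i => ⟨i, 3 * n + 1⟩⟩

/-- The subroutine `best` for the relations: sample sets are given as arrays `S j` of positions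
in the array `M` of points, with weights `w j`. In coordinate `i` it takes a tuple
`b` of the relation that minimises `f i b`, the sum over `j` of `w j` times the number of points
of the `j`-th sample whose `i`-th bit differs from `b j`; these tuples are the coordinates of the
centers. (The default is used only if a relation is empty.) -/
def bestCenters {n d k m τ : ℕ} (J : ConstrainedInstance n d k) (M : Fin m → Point d)
    (S : Fin k → Fin τ → Fin m) (w : Fin k → ℝ) : Timed (Centers k d) := do
  let bits ← Timed.fill fun i => do
    let b ← Timed.argminLoop (fun b : Fin k → Bool =>
      Timed.sumLoop fun j => do
        let bj ← Timed.op (b j)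
        let cnt ← Timed.sumLoop fun a => do
          let p ← Timed.op (S j a)
          let x ← Timed.op (M p i)
          Timed.op (if x ≠ bj then (1 : ℝ) else 0)
        Timed.op (w j * cnt)) (J.rel i).toList
    Timed.op (b.getD fun _ => false)
  Timed.fill fun j => Timed.fill fun i => Timed.op (bits i j)

/-- The guessed cluster sizes: the powers of `1 + ε/2` with exponents `0, ..., ⌈log n⌉` (logarithm
to base `1 + ε/2`); per entry one multiplication and one comparison with `n`. If `zero` is `true`,
the number `0` is put in front of them. -/
def guesses (ε : ℝ) (n : ℕ) (zero : Bool) : Timed (List ℝ) := do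
  let l ← Timed.collect (fun t : ℕ => ⟨(1 + ε / 2) ^ t, 2⟩)
    (List.range (⌈Real.logb (1 + ε / 2) n⌉₊ + 1))
  Timed.op (if zero then 0 :: l else l)

/-- All `τ`-element subsets of `m` positions, each as its increasing enumeration. -/
def subsetsLoop (m τ : ℕ) : Timed (List (Fin τ → Fin m)) := do
  let positions ← ⟨List.finRange m, m⟩
  let rows ← Timed.tuples τ positions
  Timed.select (fun s => Timed.allLoop fun a => Timed.allLoop fun b =>
    ⟨decide (a < b → s a < s b), 4⟩) rows

/-- All `k`-tuples of pairwise disjoint `τ`-element subsets of `m` positions. -/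
def disjointSubsetsLoop (m k τ : ℕ) : Timed (List (Fin k → Fin τ → Fin m)) := do
  let rows ← subsetsLoop m τ
  let families ← Timed.tuples k rows
  Timed.select (fun S => Timed.allLoop fun j => Timed.allLoop fun l =>
    Timed.allLoop fun a => Timed.allLoop fun b =>
      ⟨decide (j ≠ l → S j a ≠ S l b), 4⟩) families

/-- The multiset `M` as an array: the sampled points, followed by `τ * k` copies of each of the
`k` centers in `B`. -/
def sampleArray {n d k N : ℕ} (X : Fin n → Point d) (B : Centers k d) (τ : ℕ)
    (O : Fin N → Fin n) : Timed (Fin (N + k * (τ * k)) → Point d) :=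
  Timed.fill fun p => Timed.fill fun i =>
    ⟨Fin.append (fun u => X (O u)) (fun q => B (finProdFinEquiv.symm q).1) p i, 3⟩

/-- One round: draw `η * k` points independently, with probability proportional to the squared
distance to `B` (given as the array `D`), add the copies of `B`, and run the subroutine on all
families of disjoint subsets and all guesses of the sizes. -/
def samplingRound {n d k : ℕ} [NeZero n] (J : ConstrainedInstance n d k) (B : Centers k d)
    (D : Fin n → ℕ) (W : List ℝ) (τ η : ℕ) : Rand (List (Centers k d)) := do
  let O ← Rand.replicate (η * k) (weightedDraw D)
  Rand.lift do
    let M ← sampleArray J.points B τ O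
    let families ← disjointSubsetsLoop (η * k + k * (τ * k)) k τ
    let ws ← Timed.tuples k W
    Timed.collectMany (fun S => Timed.collect (fun w => bestCenters J M S w) ws) families

/-- The algorithm: `ζ` independent rounds, then a candidate of least cost among all center lists
found (`none` if there is no candidate). -/
def goodCenters {n d k : ℕ} [NeZero n] (J : ConstrainedInstance n d k) (B : Centers k d) (ε : ℝ)
    (zero : Bool) (τ η ζ : ℕ) : Rand (Option (Centers k d)) := do
  let D ← Rand.lift (Timed.fill fun i => nearestLoop B (J.points i))
  let W ← Rand.lift (guesses ε n zero)
  let rounds ← Rand.replicate ζ (samplingRound J B D W τ η)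
  Rand.lift do
    let indices ← ⟨List.finRange ζ, ζ⟩
    let candidates ← Timed.collectMany (fun r => Timed.op (rounds r)) indices
    Timed.argminLoop (fun C => costLoop C J.points) candidates

/-- The possible results (with their step counts) of a randomized computation. -/
def Rand.outcomes {α : Type} (p : Rand α) : Set (Timed α) := p.law.support

/-- The probability that the result of a randomized computation has a property. -/
def Rand.prob {α : Type} (p : Rand α) (E : α → Prop) : ℝ≥0∞ :=
  p.law.toOuterMeasure {r | E r.val}

/-- `m` lies between `c₀ * x` and `c₁ * x`. -/
def Between (c₀ c₁ x : ℝ) (m : ℕ) : Prop := c₀ * x ≤ m ∧ (m : ℝ) ≤ c₁ * x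

end BinaryKMeans

end

open scoped ENNReal

noncomputable section

namespace BinaryKMeans

/-! Fix an optimal list of centers and its clusters, and suppose first that `τ` uniform points of
each cluster were available. In every coordinate, the tuple of bits with fewest weighted mismatches
on these samples is in expectation nearly as good as the optimal tuple (`prodExpect_best_coord`):
choosing a different bit requires the empirical error to deviate from the true error `θ`, and the
variance of that deviation is at most `θ / τ`, proportional to the error that the optimum itself
pays. Since only expectations are compared, no union bound over coordinates or clusters is needed.
Markov's inequality (`prodExpect_markov`) turns an expected cost of at most `(1 + 3ε/4) * opt` into
success with probability at least `ε / 6`.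

Uniform cluster samples are not available, but draws proportional to the distance to `B` simulate
them. A point of a cluster is far if its drawing probability is large compared with its uniform
probability in the cluster. The remaining points are so close to `B` that moving each to its nearest
center in `B` changes the total cost by at most `ε/64 * opt`; the copies of `B` in the array stand
for them. For the far points, the drawing law is a mixture that with probability `p` imitates a
uniform cluster sample (`prodExpect_simulation`). Each cluster gets its own block of `η` draws, and
by a Chernoff-type bound every block contains `τ` imitating draws with probability at least 1/2. So
some choice of disjoint subsets and size guesses tried by the round is good with probability at
least `ε / 12` (`prodExpect_roundGood`), and `ζ ≥ 24 / ε` independent rounds fail together with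
probability at most `1/4` (`goodCenters_prob`).

Feasibility is built into the choice of tuples; it only has to be seen that a candidate always
exists, which the copies of `B` guarantee. The running time is governed by the number of families of
samples, at most `m ^ (τ * k)` with `m` polynomial in `k / ε`, times the number of guesses to the
power `k` (`goodCenters_steps_le`, `steps_bound`). -/

/-! ### Expectations over finite product weights -/

section ProdExpect

variable {ι σ α β : Type*} [Fintype ι] [DecidableEq ι] [Fintype σ] [DecidableEq σ]
  [Fintype α] [Fintype β]

/-- The expectation of `g` when the coordinates are independent and coordinate `r` has the
weights `v r`. -/
def prodExpect (v : ι → α → ℝ) (g : (ι → α) → ℝ) : ℝ :=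
  ∑ x, (∏ r, v r (x r)) * g x

/-- Nonnegative weights of total mass one. -/
structure IsWeight (u : α → ℝ) : Prop where
  nonneg : ∀ y, 0 ≤ u y
  sum_eq_one : ∑ y, u y = 1

lemma prodExpect_prod (v : ι → α → ℝ) (h : ι → α → ℝ) :
    prodExpect v (fun x => ∏ r, h r (x r)) = ∏ r, ∑ y, v r y * h r y := by
  rw [Finset.prod_univ_sum, Fintype.piFinset_univ, prodExpect]
  simp_rw [Finset.prod_mul_distrib]

lemma prodExpect_const (v : ι → α → ℝ) (hv : ∀ r, IsWeight (v r)) (c : ℝ) :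
    prodExpect v (fun _ => c) = c := by
  have := prodExpect_prod v (fun _ _ => 1)
  simp only [Finset.prod_const_one, mul_one, (hv _).sum_eq_one, prodExpect] at this ⊢
  rw [← Finset.sum_mul, this, one_mul]

lemma prodExpect_mono (v : ι → α → ℝ) (hv : ∀ r, IsWeight (v r)) {g h : (ι → α) → ℝ}
    (hgh : ∀ x, g x ≤ h x) : prodExpect v g ≤ prodExpect v h :=
  Finset.sum_le_sum fun x _ =>
    mul_le_mul_of_nonneg_left (hgh x) (Finset.prod_nonneg fun r _ => (hv r).nonneg _)

lemma prodExpect_add (v : ι → α → ℝ) (g h : (ι → α) → ℝ) :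
    prodExpect v (fun x => g x + h x) = prodExpect v g + prodExpect v h := by
  simp only [prodExpect, mul_add, Finset.sum_add_distrib]

lemma prodExpect_sub (v : ι → α → ℝ) (g h : (ι → α) → ℝ) :
    prodExpect v (fun x => g x - h x) = prodExpect v g - prodExpect v h := by
  simp only [prodExpect, mul_sub, Finset.sum_sub_distrib]

lemma prodExpect_const_mul (v : ι → α → ℝ) (c : ℝ) (g : (ι → α) → ℝ) :
    prodExpect v (fun x => c * g x) = c * prodExpect v g := by
  simp only [prodExpect, Finset.mul_sum]
  exact Finset.sum_congr rfl fun x _ => by ring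

lemma prodExpect_sum {κ : Type*} (s : Finset κ) (v : ι → α → ℝ) (g : κ → (ι → α) → ℝ) :
    prodExpect v (fun x => ∑ i ∈ s, g i x) = ∑ i ∈ s, prodExpect v (g i) := by
  simp only [prodExpect, Finset.mul_sum]
  exact Finset.sum_comm

/-- The marginal of a product on an injective family of coordinates is a product. -/
lemma prodExpect_comp (v : ι → α → ℝ) (hv : ∀ r, IsWeight (v r)) {e : σ → ι}
    (he : Function.Injective e) (g : (σ → α) → ℝ) :
    prodExpect v (fun x => g (x ∘ e)) = prodExpect (fun s => v (e s)) g := by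
  classical
  have key : ∀ S : σ → α,
      prodExpect v (fun x => if x ∘ e = S then (1 : ℝ) else 0) = ∏ s, v (e s) (S s) := by
    intro S
    -- The indicator factors over all coordinates `r`; outside the range of `e` the condition is
    -- vacuous and the factor integrates to 1.
    have h1 : ∀ x : ι → α, (if x ∘ e = S then (1 : ℝ) else 0)
        = ∏ r, (if ∀ s, e s = r → x r = S s then (1 : ℝ) else 0) := by
      intro x
      rw [Finset.prod_ite_zero]
      simp only [Finset.mem_univ, true_implies, Finset.prod_const_one]
      congr 1
      simp only [funext_iff, Function.comp, eq_iff_iff]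
      exact ⟨fun h r s hs => by rw [← hs, h], fun h s => h _ s rfl⟩
    simp_rw [h1]
    rw [prodExpect_prod v (fun r y => if ∀ s, e s = r → y = S s then (1 : ℝ) else 0)]
    rw [← Finset.prod_subset (Finset.subset_univ (Finset.univ.image e)),
      Finset.prod_image (fun a _ b _ h => he h)]
    · refine Finset.prod_congr rfl fun s _ => ?_
      rw [Finset.sum_eq_single (S s)]
      · rw [if_pos, mul_one]
        intro s' hs'
        rw [he hs']
      · intro y _ hy
        rw [if_neg, mul_zero]
        exact fun h => hy (h s rfl)
      · simp
    · intro r _ hr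
      have : ∀ y, ∀ s, e s = r → y = S s := fun y s hs =>
        absurd (Finset.mem_image.2 ⟨s, Finset.mem_univ _, hs⟩) hr
      refine (Finset.sum_congr rfl fun y _ => ?_).trans (hv r).sum_eq_one
      rw [if_pos (this y), mul_one]
  have h2 : ∀ x : ι → α, g (x ∘ e) = ∑ S, g S * (if x ∘ e = S then (1 : ℝ) else 0) := by
    intro x
    simp
  simp_rw [h2]
  rw [prodExpect_sum]
  simp_rw [prodExpect_const_mul, key, prodExpect]
  exact Finset.sum_congr rfl fun S _ => mul_comm _ _

/-- Independent centered variables are uncorrelated, so only the diagonal terms of the square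
survive. -/
lemma prodExpect_sq_sum (u : α → ℝ) (hu : IsWeight u) (φ : α → ℝ) (hφ : ∑ y, u y * φ y = 0) :
    prodExpect (fun _ : σ => u) (fun x => (∑ t, φ (x t)) ^ 2)
      = Fintype.card σ * ∑ y, u y * φ y ^ 2 := by
  have hpair : ∀ s t : σ, prodExpect (fun _ : σ => u) (fun x => φ (x s) * φ (x t))
      = if s = t then ∑ y, u y * φ y ^ 2 else 0 := by
    intro s t
    have h1 : ∀ x : σ → α, φ (x s) * φ (x t)
        = ∏ r, ((if r = s then φ (x r) else 1) * (if r = t then φ (x r) else 1)) := by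
      intro x
      rw [Finset.prod_mul_distrib, Finset.prod_ite_eq' Finset.univ s (fun r => φ (x r)),
        Finset.prod_ite_eq' Finset.univ t (fun r => φ (x r))]
      simp
    simp_rw [h1]
    rw [prodExpect_prod (fun _ : σ => u)
      (fun r y => (if r = s then φ y else 1) * (if r = t then φ y else 1))]
    split_ifs with hst
    · subst hst
      rw [Finset.prod_eq_single s]
      · simp [sq]
      · intro r _ hr
        simp [hr, hu.sum_eq_one]
      · simp
    · refine Finset.prod_eq_zero (Finset.mem_univ s) ?_
      simpa [hst] using hφ
  simp_rw [sq (∑ t, φ _), Finset.sum_mul_sum]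
  rw [prodExpect_sum]
  simp_rw [prodExpect_sum, hpair]
  simp

/-- The indicator of a proposition. -/
def ind (P : Prop) : ℝ := open Classical in if P then 1 else 0

lemma ind_nonneg (P : Prop) : 0 ≤ ind P := by
  unfold ind; split_ifs <;> norm_num

lemma ind_of {P : Prop} (h : P) : ind P = 1 := if_pos h

lemma ind_of_not {P : Prop} (h : ¬P) : ind P = 0 := if_neg h

lemma ind_mono {P Q : Prop} (h : P → Q) : ind P ≤ ind Q := by
  by_cases hP : P
  · rw [ind_of hP, ind_of (h hP)]
  · rw [ind_of_not hP]; exact ind_nonneg _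

/-- Markov's inequality, around a nonnegative value `c`. -/
lemma prodExpect_markov (v : ι → α → ℝ) (hv : ∀ r, IsWeight (v r)) (g : (ι → α) → ℝ)
    (hg : ∀ x, 0 ≤ g x) {c ε : ℝ} (hc : 0 ≤ c) (hε : 0 < ε) (hε' : ε ≤ 1 / 2)
    (h : prodExpect v g ≤ (1 + 3 / 4 * ε) * c) :
    ε / 6 ≤ prodExpect v (fun x => ind (g x ≤ (1 + ε) * c)) := by
  have hcompl : prodExpect v (fun x => ind (g x ≤ (1 + ε) * c))
      = 1 - prodExpect v (fun x => 1 - ind (g x ≤ (1 + ε) * c)) := by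
    rw [prodExpect_sub, prodExpect_const v hv]; ring
  -- For `c = 0` one cannot divide by `c`; instead `g` vanishes wherever the weight is positive.
  rcases hc.eq_or_lt with rfl | hc
  · have h0 : prodExpect v (fun x => 1 - ind (g x ≤ (1 + ε) * 0)) ≤ 0 := by
      have hz : ∀ x, 0 ≤ (∏ r, v r (x r)) * g x := fun x =>
        mul_nonneg (Finset.prod_nonneg fun r _ => (hv r).nonneg _) (hg x)
      have hzero : prodExpect v g = 0 :=
        le_antisymm (by simpa using h) (Finset.sum_nonneg fun x _ => hz x)
      rw [prodExpect, Finset.sum_eq_zero_iff_of_nonneg fun x _ => hz x] at hzero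
      refine Finset.sum_nonpos fun x hx => ?_
      rcases mul_eq_zero.1 (hzero x hx) with h1 | h1
      · simp [h1]
      · have h2 : g x ≤ (1 + ε) * 0 := by simp [h1]
        show _ * (1 - ind (g x ≤ (1 + ε) * 0)) ≤ 0
        rw [ind_of h2, sub_self, mul_zero]
    rw [hcompl]
    linarith
  · have h1 : prodExpect v (fun x => (1 + ε) * c * (1 - ind (g x ≤ (1 + ε) * c)))
        ≤ prodExpect v g := by
      refine prodExpect_mono v hv fun x => ?_
      by_cases hx : g x ≤ (1 + ε) * c
      · rw [ind_of hx]; simpa using hg x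
      · rw [ind_of_not hx]; linarith
    rw [prodExpect_const_mul] at h1
    rw [hcompl]
    set P := prodExpect v (fun x => 1 - ind (g x ≤ (1 + ε) * c))
    -- The success probability is thus at least `(ε / 4) / (1 + ε)`, which is at least `ε / 6`
    -- because `ε ≤ 1 / 2`.
    have h2 : (1 + ε) * P ≤ 1 + 3 / 4 * ε := by
      have : c * ((1 + ε) * P) ≤ c * (1 + 3 / 4 * ε) := by nlinarith
      exact le_of_mul_le_mul_left this hc
    nlinarith

/-- If every draw `z r` can be produced from a draw with weights `v r` by a kernel `K r`, then an
event for `z` is at least as likely as any event that forces it. -/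
lemma prodExpect_coupling (q : ι → β → ℝ) (v : ι → α → ℝ) (hv : ∀ r, IsWeight (v r))
    (K : ι → α → β → ℝ) (hK : ∀ r y, IsWeight (K r y))
    (hq : ∀ r z, q r z = ∑ y, v r y * K r y z) (F : (ι → β) → Prop) (G : (ι → α) → Prop)
    (hFG : ∀ z y, G y → (∀ r, K r (y r) (z r) ≠ 0) → F z) :
    prodExpect v (fun y => ind (G y)) ≤ prodExpect q (fun z => ind (F z)) := by
  have h1 : prodExpect q (fun z => ind (F z))
      = ∑ y : ι → α, (∏ r, v r (y r)) *
          prodExpect (fun r => K r (y r)) (fun z => ind (F z)) := by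
    simp only [prodExpect, hq]
    simp_rw [Finset.prod_univ_sum, Fintype.piFinset_univ, Finset.sum_mul, Finset.mul_sum]
    rw [Finset.sum_comm]
    refine Finset.sum_congr rfl fun y _ => Finset.sum_congr rfl fun z _ => ?_
    rw [Finset.prod_mul_distrib, mul_assoc]
  rw [h1]
  refine Finset.sum_le_sum fun y _ => mul_le_mul_of_nonneg_left ?_
    (Finset.prod_nonneg fun r _ => (hv r).nonneg _)
  show ind (G y) ≤ _
  by_cases hG : G y
  · rw [← prodExpect_const (fun r => K r (y r)) (fun r => hK r _) (ind (G y))]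
    refine Finset.sum_le_sum fun z _ => ?_
    by_cases hz : ∀ r, K r (y r) (z r) ≠ 0
    · beta_reduce
      rw [ind_of hG, ind_of (hFG z y hG hz)]
    · push Not at hz
      obtain ⟨r, hr⟩ := hz
      rw [Finset.prod_eq_zero (Finset.mem_univ r) hr]
      simp
  · rw [ind_of_not hG]
    exact Finset.sum_nonneg fun z _ => mul_nonneg
      (Finset.prod_nonneg fun r _ => (hK r _).nonneg _) (ind_nonneg _)

/-- Fubini; it allows conditioning on all coins before looking at the samples attached to them. -/
lemma prodExpect_pair (v : ι → α → ℝ) (w : ι → β → ℝ) (g : (ι → α × β) → ℝ) :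
    prodExpect (fun r (y : α × β) => v r y.1 * w r y.2) g
      = prodExpect v (fun x => prodExpect w (fun y => g (fun r => (x r, y r)))) := by
  simp only [prodExpect, Finset.mul_sum]
  rw [← Fintype.sum_prod_type']
  refine Fintype.sum_equiv (Equiv.arrowProdEquivProdArrow ι _ _) _ _ fun x => ?_
  rw [Finset.prod_mul_distrib, mul_assoc]
  rfl

/-- The weights of a coin that shows `true` with probability `p`. -/
def coin (p : ℝ) (b : Bool) : ℝ := if b then p else 1 - p

lemma isWeight_coin {p : ℝ} (h0 : 0 ≤ p) (h1 : p ≤ 1) : IsWeight (coin p) :=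
  ⟨fun b => by cases b <;> simp [coin] <;> linarith, by simp [coin]⟩

/-- Few heads among independent coins are unlikely. -/
lemma prodExpect_few_heads {p : ℝ} (h0 : 0 ≤ p) (h1 : p ≤ 1) {e : σ → ι}
    (he : Function.Injective e) (τ : ℕ) :
    prodExpect (fun _ : ι => coin p)
        (fun c => ind ((Finset.univ.filter fun t => c (e t) = true).card < τ))
      ≤ 2 ^ τ * (1 - p / 2) ^ Fintype.card σ := by
  refine (prodExpect_comp (fun _ : ι => coin p) (fun _ => isWeight_coin h0 h1) he
    (fun c => ind ((Finset.univ.filter fun t => c t = true).card < τ))).trans_le ?_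
  -- Exponential Markov inequality for `(1/2) ^ (number of heads)`, whose expectation factors over
  -- the coins.
  calc prodExpect (fun _ : σ => coin p)
        (fun c => ind ((Finset.univ.filter fun t => c t = true).card < τ))
      ≤ prodExpect (fun _ : σ => coin p)
        (fun c => 2 ^ τ * ∏ t, (if c t = true then (1 / 2 : ℝ) else 1)) := by
        refine prodExpect_mono _ (fun _ => isWeight_coin h0 h1) fun c => ?_
        rw [Finset.prod_ite, Finset.prod_const, Finset.prod_const_one, mul_one]
        by_cases h : (Finset.univ.filter fun t => c t = true).card < τ
        · rw [ind_of h, div_pow, one_pow, mul_one_div, one_le_div (by positivity)]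
          exact pow_le_pow_right₀ (by norm_num) h.le
        · rw [ind_of_not h]; positivity
    _ = 2 ^ τ * (1 - p / 2) ^ Fintype.card σ := by
        rw [prodExpect_const_mul, prodExpect_prod (fun _ : σ => coin p)
          (fun _ b => if b = true then (1 / 2 : ℝ) else 1)]
        have : ∑ y, coin p y * (if y = true then (1 / 2 : ℝ) else 1) = 1 - p / 2 := by
          simp [coin]; ring
        rw [this]
        simp

end ProdExpect

/-- Draws from `q` can be used in place of draws from the weights `u j`, up to the points outside
of `far j`: `k` blocks of `η` draws contain, with high probability, `k` samples of size `τ`. -/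
lemma prodExpect_simulation {n k η τ : ℕ} (q : Fin n → ℝ) (hq : IsWeight q)
    (u : Fin k → Fin n → ℝ) (hu : ∀ j, IsWeight (u j)) (far : Fin k → Fin n → Prop)
    {p : ℝ} (h0 : 0 ≤ p) (h1 : p < 1) (hfar : ∀ j y, far j y → p * u j y ≤ q y)
    (F : (Fin k × Fin η → Fin n) → Prop) (G : (Fin k × Fin τ → Fin n) → Prop)
    (hFG : ∀ z S (e : Fin k → Fin τ ↪ Fin η),
      (∀ j t, far j (S (j, t)) → z (j, e j t) = S (j, t)) → G S → F z) :
    (1 - k * (2 ^ τ * (1 - p / 2) ^ η)) * prodExpect (fun r => u r.1) (fun S => ind (G S))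
      ≤ prodExpect (fun _ => q) (fun z => ind (F z)) := by
  classical
  -- the residual kernel
  let m : Fin k → Fin n → ℝ := fun j y => if far j y then p * u j y else 0
  let ρ : Fin k → ℝ := fun j => 1 - ∑ y, m j y
  have hm0 : ∀ j y, 0 ≤ m j y := fun j y => by
    simp only [m]; split_ifs
    · exact mul_nonneg h0 ((hu j).nonneg y)
    · exact le_rfl
  have hmq : ∀ j y, m j y ≤ q y := fun j y => by
    simp only [m]; split_ifs with h
    · exact hfar j y h
    · exact hq.nonneg y
  have hρ : ∀ j, 0 < ρ j := fun j => by
    have : ∑ y, m j y ≤ ∑ y, p * u j y := Finset.sum_le_sum fun y _ => by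
      simp only [m]; split_ifs
      · exact le_rfl
      · exact mul_nonneg h0 ((hu j).nonneg y)
    rw [← Finset.mul_sum, (hu j).sum_eq_one, mul_one] at this
    simp only [ρ]; linarith
  -- On heads with a far sample the draw copies the sample; in all other cases it comes from the
  -- normalized excess of `q` over the copied mass `m`, nonnegative by `hmq`.
  let K : Fin k × Fin η → Bool × Fin n → Fin n → ℝ := fun r y z =>
    if y.1 = true ∧ far r.1 y.2 then (if z = y.2 then 1 else 0) else (q z - m r.1 z) / ρ r.1
  let v : Fin k × Fin η → Bool × Fin n → ℝ := fun r y => coin p y.1 * u r.1 y.2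
  have hcoin := isWeight_coin h0 h1.le
  have hv : ∀ r, IsWeight (v r) := fun r =>
    ⟨fun y => mul_nonneg (hcoin.nonneg _) ((hu _).nonneg _), by
      rw [Fintype.sum_prod_type]
      simp only [v, ← Finset.mul_sum, (hu _).sum_eq_one, mul_one, hcoin.sum_eq_one]⟩
  have hK : ∀ r y, IsWeight (K r y) := by
    intro r y
    by_cases h : y.1 = true ∧ far r.1 y.2
    · simp only [K, if_pos h]
      exact ⟨fun z => by split_ifs <;> norm_num, by simp⟩
    · simp only [K, if_neg h]
      refine ⟨fun z => div_nonneg (sub_nonneg.2 (hmq _ _)) (hρ _).le, ?_⟩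
      rw [← Finset.sum_div, Finset.sum_sub_distrib, hq.sum_eq_one]
      exact div_self (hρ _).ne'
  have hqK : ∀ r z, q z = ∑ y, v r y * K r y z := by
    intro r z
    have hres : ∀ y, v r y * K r y z
        = (if y.1 = true ∧ far r.1 y.2 then v r y * ((if z = y.2 then 1 else 0)
          - (q z - m r.1 z) / ρ r.1) else 0) + v r y * ((q z - m r.1 z) / ρ r.1) := by
      intro y
      simp only [K]
      split_ifs <;> ring
    simp_rw [hres]
    rw [Finset.sum_add_distrib, ← Finset.sum_mul, (hv r).sum_eq_one, Fintype.sum_prod_type]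
    simp only [Fintype.univ_bool, Finset.mem_singleton, Bool.true_eq_false, not_false_eq_true,
      Finset.sum_insert, Finset.sum_singleton, Bool.false_eq_true, false_and, if_false,
      Finset.sum_const_zero, true_and, add_zero, v, coin, if_true]
    have : ∀ y, (if far r.1 y then p * u r.1 y * ((if z = y then 1 else 0)
          - (q z - m r.1 z) / ρ r.1) else 0)
        = (if z = y then m r.1 y else 0) - m r.1 y * ((q z - m r.1 z) / ρ r.1) := by
      intro y
      simp only [m]
      split_ifs <;> ring
    simp_rw [this]
    rw [Finset.sum_sub_distrib, ← Finset.sum_mul, Finset.sum_ite_eq, if_pos (Finset.mem_univ _)]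
    have h3 : ∑ y, m r.1 y = 1 - ρ r.1 := by simp [ρ]
    rw [h3]
    have := (hρ r.1).ne'
    field_simp
    ring
  -- the event that all blocks have enough heads
  let E : (Fin k × Fin η → Bool) → Prop := fun c =>
    ∀ j, τ ≤ (Finset.univ.filter fun t => c (j, t) = true).card
  have hE : 1 - k * (2 ^ τ * (1 - p / 2) ^ η)
      ≤ prodExpect (fun _ => coin p) (fun c => ind (E c)) := by
    have hle : ∀ c, 1 - ∑ j, ind ((Finset.univ.filter fun t => c (j, t) = true).card < τ)
        ≤ ind (E c) := by
      intro c
      by_cases h : E c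
      · rw [ind_of h]
        have := Finset.sum_nonneg (s := Finset.univ) fun (j : Fin k) _ =>
          ind_nonneg ((Finset.univ.filter fun t => c (j, t) = true).card < τ)
        linarith
      · rw [ind_of_not h]
        simp only [E] at h
        push Not at h
        obtain ⟨j, hj⟩ := h
        have := Finset.single_le_sum (f := fun j =>
          ind ((Finset.univ.filter fun t => c (j, t) = true).card < τ))
          (fun j _ => ind_nonneg _) (Finset.mem_univ j)
        simp only [ind_of hj] at this
        linarith
    refine le_trans ?_ (prodExpect_mono _ (fun _ => hcoin) hle)
    rw [prodExpect_sub, prodExpect_const _ (fun _ => hcoin), prodExpect_sum]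
    have : ∑ j : Fin k, prodExpect (fun _ : Fin k × Fin η => coin p)
        (fun c => ind ((Finset.univ.filter fun t => c (j, t) = true).card < τ))
        ≤ ∑ _j : Fin k, 2 ^ τ * (1 - p / 2) ^ η := by
      refine Finset.sum_le_sum fun j _ => ?_
      have := prodExpect_few_heads (ι := Fin k × Fin η) h0 h1.le (e := fun t : Fin η => (j, t))
        (fun a b h => by simpa using h) τ
      rwa [Fintype.card_fin] at this
    rw [Finset.sum_const, Finset.card_univ, Fintype.card_fin, nsmul_eq_mul] at this
    linarith
  -- The first `τ` heads of each block. This selection depends on the coins only, so the selected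
  -- samples keep their independent laws.
  have hex : ∀ c, E c → ∃ e : Fin k → Fin τ ↪ Fin η, ∀ j t, c (j, e j t) = true := by
    intro c hc
    refine ⟨fun j => (Fin.castLEEmb (hc j)).trans
      ((Finset.univ.filter fun t => c (j, t) = true).orderEmbOfFin rfl).toEmbedding, fun j t => ?_⟩
    have := Finset.orderEmbOfFin_mem (Finset.univ.filter fun t => c (j, t) = true) rfl
      (Fin.castLE (hc j) t)
    simpa using (Finset.mem_filter.1 this).2
  choose e he using hex
  refine le_trans ?_ (prodExpect_coupling (fun _ => q) v hv K hK hqK F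
    (fun y => ∃ hc : E (fun r => (y r).1),
      G (fun s => (y (s.1, e (fun r => (y r).1) hc s.1 s.2)).2)) ?_)
  · rw [show v = fun r (y : Bool × Fin n) =>
      (fun _ : Fin k × Fin η => coin p) r y.1 * (fun r : Fin k × Fin η => u r.1) r y.2 from rfl,
      prodExpect_pair]
    -- Once the coins are fixed, the selected positions are a fixed injective family, and the
    -- marginal there is the product of the cluster laws.
    have hinner : ∀ c : Fin k × Fin η → Bool,
        prodExpect (fun r : Fin k × Fin η => u r.1) (fun x => ind (∃ hc : E c,
          G (fun s => x (s.1, e c hc s.1 s.2))))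
        = prodExpect (fun r => u r.1) (fun S => ind (G S)) * ind (E c) := by
      intro c
      by_cases hc : E c
      · simp only [exists_prop_of_true hc, ind_of hc, mul_one]
        exact prodExpect_comp (fun r : Fin k × Fin η => u r.1) (fun r => hu _)
          (e := fun s : Fin k × Fin τ => (s.1, e c hc s.1 s.2))
          (fun a b h => by
            obtain ⟨a1, a2⟩ := a
            obtain ⟨b1, b2⟩ := b
            simp only [Prod.mk.injEq] at h
            obtain ⟨rfl, h⟩ := h
            simpa using h) (fun S => ind (G S))
      · simp only [exists_prop_of_false hc, ind_of_not hc, ind_of_not not_false, mul_zero]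
        exact prodExpect_const _ (fun r => hu _) 0
    simp only [hinner]
    rw [prodExpect_const_mul, mul_comm]
    refine mul_le_mul_of_nonneg_left hE ?_
    rw [← prodExpect_const (fun r : Fin k × Fin τ => u r.1) (fun r => hu _) 0]
    exact prodExpect_mono _ (fun r => hu _) fun S => ind_nonneg _
  · rintro z y ⟨hc, hG⟩ hz
    refine hFG z _ (e (fun r => (y r).1) hc) (fun j t hf => ?_) hG
    have := hz (j, e (fun r => (y r).1) hc j t)
    have hcond : (y (j, e (fun r => (y r).1) hc j t)).1 = true ∧
        far j (y (j, e (fun r => (y r).1) hc j t)).2 := ⟨he (fun r => (y r).1) hc j t, hf⟩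
    simp only [K, if_pos hcond] at this
    by_contra hne
    exact this (if_neg hne)

/-! ### Analysis of the choice of the best centers -/

/-- The indicator of a difference of two bits. -/
def neq (a b : Bool) : ℝ := if a ≠ b then 1 else 0

lemma neq_nonneg (a b : Bool) : 0 ≤ neq a b := by
  unfold neq; split_ifs <;> norm_num

/-- There are only two bits, so changing the answer exchanges matches and mismatches. Hence the true
and the empirical errors of a wrong choice are the complements of those of the right one. -/
lemma neq_of_ne {b c : Bool} (h : c ≠ b) (a : Bool) : neq a c = 1 - neq a b := by
  revert h
  cases a <;> cases b <;> cases c <;> simp [neq]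

lemma neq_sq (a b : Bool) : neq a b ^ 2 = neq a b := by
  unfold neq; split_ifs <;> norm_num

lemma hammingDist_eq_sum_neq {d : ℕ} (x y : Point d) :
    (hammingDist x y : ℝ) = ∑ i, neq (x i) (y i) := by
  simp only [hammingDist, neq, Finset.sum_boole]

section Best

variable {n k τ : ℕ}

/-- Choosing for a sample the tuple of bits with fewest (weighted) mismatches is nearly optimal in
expectation. -/
lemma prodExpect_best_coord (u : Fin k → Fin n → ℝ) (hu : ∀ j, IsWeight (u j)) (hτ : 0 < τ)
    (bit : Fin k → Fin n → Bool) (w : Fin k → ℝ) (hw : ∀ j, 0 ≤ w j) (b : Fin k → Bool)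
    (bh : (Fin k × Fin τ → Fin n) → Fin k → Bool)
    (hbh : ∀ S, ∑ j, w j * ∑ t, neq (bit j (S (j, t))) (bh S j)
      ≤ ∑ j, w j * ∑ t, neq (bit j (S (j, t))) (b j)) {κ : ℝ} (hκ : 0 < κ) :
    prodExpect (fun r => u r.1) (fun S => ∑ j, w j * ∑ x, u j x * neq (bit j x) (bh S j))
      ≤ (1 + (2 * κ + (1 + κ) ^ 2 / (κ * τ))) * ∑ j, w j * ∑ x, u j x * neq (bit j x) (b j) := by
  have hτ' : (0 : ℝ) < τ := by exact_mod_cast hτ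
  set θ : Fin k → ℝ := fun j => ∑ x, u j x * neq (bit j x) (b j) with hθ
  let Y : (Fin k × Fin τ → Fin n) → Fin k → ℝ := fun S j =>
    (∑ t, neq (bit j (S (j, t))) (b j)) / τ - θ j
  have hpt : ∀ S, ∑ j, w j * ∑ x, u j x * neq (bit j x) (bh S j)
      ≤ ∑ j, w j * ((1 + 2 * κ) * θ j + (1 + κ) ^ 2 / κ * Y S j ^ 2) := by
    intro S
    -- The optimality of `bh` on the sample is added with the factor `1 + κ` instead of 1; the
    -- surplus produces the slack `-κ` in every `j` where the two bits differ.
    have h1 : 0 ≤ (1 + κ) / τ * (∑ j, w j * ∑ t, neq (bit j (S (j, t))) (b j)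
        - ∑ j, w j * ∑ t, neq (bit j (S (j, t))) (bh S j)) :=
      mul_nonneg (by positivity) (sub_nonneg.2 (hbh S))
    refine (le_add_of_nonneg_right h1).trans ?_
    rw [← Finset.sum_sub_distrib, Finset.mul_sum, ← Finset.sum_add_distrib]
    refine Finset.sum_le_sum fun j _ => ?_
    have hsq : 0 ≤ (1 + κ) ^ 2 / κ * Y S j ^ 2 := by positivity
    have hθ0 : 0 ≤ θ j :=
      Finset.sum_nonneg fun x _ => mul_nonneg ((hu j).nonneg x) (neq_nonneg _ _)
    rw [← mul_sub, mul_left_comm ((1 + κ) / τ), ← mul_add]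
    refine mul_le_mul_of_nonneg_left ?_ (hw j)
    by_cases hb : bh S j = b j
    · rw [hb, sub_self, mul_zero, add_zero]
      change θ j ≤ _
      nlinarith
    · have e1 : ∑ x, u j x * neq (bit j x) (bh S j) = 1 - θ j := by
        simp_rw [neq_of_ne hb, mul_sub, mul_one]
        rw [Finset.sum_sub_distrib, (hu j).sum_eq_one]
      have e2 : ∑ t, neq (bit j (S (j, t))) (bh S j)
          = τ - ∑ t, neq (bit j (S (j, t))) (b j) := by
        simp_rw [neq_of_ne hb]
        rw [Finset.sum_sub_distrib]
        simp
      have e3 : ∑ t, neq (bit j (S (j, t))) (b j) = τ * (Y S j + θ j) := by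
        simp only [Y]
        field_simp
        ring
      rw [e1, e2, e3]
      have e4 : (1 + κ) / τ * (τ * (Y S j + θ j) - (τ - τ * (Y S j + θ j)))
          = (1 + κ) * (2 * (Y S j + θ j) - 1) := by
        field_simp
        ring
      rw [e4]
      -- Completing the square: the linear term `2 * (1 + κ) * Y` is absorbed by the slack `κ` and a
      -- multiple of `Y ^ 2`.
      have e5 : 0 ≤ ((1 + κ) * Y S j - κ) ^ 2 / κ := by positivity
      have e6 : ((1 + κ) * Y S j - κ) ^ 2 / κ
          = (1 + κ) ^ 2 / κ * Y S j ^ 2 - 2 * (1 + κ) * Y S j + κ := by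
        field_simp
        ring
      linarith
  refine (prodExpect_mono _ (fun r => hu r.1) hpt).trans ?_
  rw [prodExpect_sum, Finset.mul_sum]
  refine Finset.sum_le_sum fun j _ => ?_
  rw [prodExpect_const_mul, mul_left_comm]
  refine mul_le_mul_of_nonneg_left ?_ (hw j)
  rw [prodExpect_add, prodExpect_const (fun r : Fin k × Fin τ => u r.1) (fun r => hu r.1),
    prodExpect_const_mul]
  have hvar : prodExpect (fun r : Fin k × Fin τ => u r.1) (fun S => Y S j ^ 2) ≤ θ j / τ := by
    let φ : Fin n → ℝ := fun x => neq (bit j x) (b j) - θ j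
    have hφ0 : ∑ x, u j x * φ x = 0 := by
      simp only [φ, mul_sub]
      rw [Finset.sum_sub_distrib, ← Finset.sum_mul, (hu j).sum_eq_one]
      simp [θ]
    -- The variance `θ - θ ^ 2` of a bit is at most its mean; this makes the final error
    -- multiplicative rather than additive.
    have hφ2 : ∑ x, u j x * φ x ^ 2 ≤ θ j := by
      have : ∀ x, u j x * φ x ^ 2
          = (1 - 2 * θ j) * (u j x * neq (bit j x) (b j)) + θ j ^ 2 * u j x := by
        intro x
        have := neq_sq (bit j x) (b j)
        simp only [φ]
        linear_combination u j x * this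
      simp_rw [this]
      rw [Finset.sum_add_distrib, ← Finset.mul_sum, ← Finset.mul_sum, (hu j).sum_eq_one]
      change (1 - 2 * θ j) * θ j + _ ≤ _
      nlinarith [sq_nonneg (θ j)]
    have hY : ∀ S : Fin k × Fin τ → Fin n, Y S j ^ 2
        = 1 / (τ : ℝ) ^ 2 * (∑ t, φ ((S ∘ fun t : Fin τ => (j, t)) t)) ^ 2 := by
      intro S
      simp only [Y, φ, Function.comp]
      rw [Finset.sum_sub_distrib]
      simp only [Finset.sum_const, Finset.card_univ, Fintype.card_fin, nsmul_eq_mul]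
      field_simp
    simp_rw [hY]
    rw [prodExpect_const_mul, prodExpect_comp (fun r : Fin k × Fin τ => u r.1) (fun r => hu r.1)
      (e := fun t : Fin τ => (j, t)) (fun a b h => by simpa using h)
      (fun x : Fin τ → Fin n => (∑ t, φ (x t)) ^ 2), prodExpect_sq_sum (u j) (hu j) φ hφ0,
      Fintype.card_fin]
    calc 1 / (τ : ℝ) ^ 2 * (τ * ∑ y, u j y * φ y ^ 2)
        ≤ 1 / (τ : ℝ) ^ 2 * (τ * θ j) := by gcongr
      _ = θ j / τ := by field_simp
  calc (1 + 2 * κ) * θ j + (1 + κ) ^ 2 / κ * prodExpect (fun r : Fin k × Fin τ => u r.1)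
        (fun S => Y S j ^ 2)
      ≤ (1 + 2 * κ) * θ j + (1 + κ) ^ 2 / κ * (θ j / τ) := by gcongr
    _ = (1 + (2 * κ + (1 + κ) ^ 2 / (κ * τ))) * θ j := by field_simp; ring

/-- Hamming distance and the choice of tuples both decompose over the coordinates, and the loss
factor is the same in each, so the one-coordinate bounds add up. -/
lemma prodExpect_best {d : ℕ} (u : Fin k → Fin n → ℝ) (hu : ∀ j, IsWeight (u j)) (hτ : 0 < τ)
    (Y : Fin k → Fin n → Point d) (w : Fin k → ℝ) (hw : ∀ j, 0 ≤ w j) (C : Centers k d)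
    (Ch : (Fin k × Fin τ → Fin n) → Centers k d)
    (hCh : ∀ S i, ∑ j, w j * ∑ t, neq (Y j (S (j, t)) i) (Ch S j i)
      ≤ ∑ j, w j * ∑ t, neq (Y j (S (j, t)) i) (C j i)) {κ : ℝ} (hκ : 0 < κ) :
    prodExpect (fun r => u r.1) (fun S => ∑ j, w j * ∑ x, u j x * hammingDist (Y j x) (Ch S j))
      ≤ (1 + (2 * κ + (1 + κ) ^ 2 / (κ * τ))) *
        ∑ j, w j * ∑ x, u j x * hammingDist (Y j x) (C j) := by
  have hsum : ∀ D : Centers k d, ∑ j, w j * ∑ x, u j x * hammingDist (Y j x) (D j)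
      = ∑ i, ∑ j, w j * ∑ x, u j x * neq (Y j x i) (D j i) := by
    intro D
    simp_rw [hammingDist_eq_sum_neq, Finset.mul_sum]
    refine Eq.trans ?_ Finset.sum_comm
    exact Finset.sum_congr rfl fun j _ => Finset.sum_comm
  simp_rw [hsum]
  rw [prodExpect_sum, Finset.mul_sum]
  exact Finset.sum_le_sum fun i _ => prodExpect_best_coord u hu hτ (fun j x => Y j x i) w hw
    (fun j => C j i) (fun S j => Ch S j i) (fun S => hCh S i) hκ

end Best

/-! ### Results of the deterministic subroutines -/

namespace Timed

lemma val_bind {α β : Type} (x : Timed α) (f : α → Timed β) : (x >>= f).val = (f x.val).val := rfl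

lemma steps_bind {α β : Type} (x : Timed α) (f : α → Timed β) :
    (x >>= f).steps = x.steps + (f x.val).steps := rfl

lemma mem_tuples {α : Type} {l : List α} : ∀ {m : ℕ} {t : Fin m → α},
    t ∈ (tuples m l).val ↔ ∀ i, t i ∈ l
  | 0, t => by
    simp only [tuples, op, List.mem_singleton, IsEmpty.forall_iff, iff_true]
    exact funext fun i => i.elim0
  | m + 1, t => by
    simp only [tuples, val_bind, collectMany, collect, List.mem_flatMap, List.mem_map, mem_tuples]
    constructor
    · rintro ⟨a, ha, s, hs, rfl⟩ i
      refine Fin.cases ?_ ?_ i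
      · simpa using ha
      · intro i; simpa using hs i
    · intro h
      exact ⟨t 0, h 0, Fin.tail t, fun i => h i.succ, Fin.cons_self_tail t⟩

lemma length_tuples {α : Type} (l : List α) : ∀ m : ℕ,
    (tuples m l).val.length = l.length ^ m
  | 0 => by simp [tuples, op]
  | m + 1 => by
    simp only [tuples, val_bind, collectMany, collect, List.length_flatMap, List.length_map,
      length_tuples l m]
    simp [pow_succ, mul_comm]

end Timed

lemma mem_subsetsLoop {m τ : ℕ} {s : Fin τ → Fin m} :
    s ∈ (subsetsLoop m τ).val ↔ StrictMono s := by
  simp only [subsetsLoop, Timed.val_bind, Timed.select, List.mem_filter, Timed.mem_tuples,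
    List.mem_finRange, implies_true, Timed.allLoop, decide_eq_true_eq, true_and]
  rfl

lemma mem_disjointSubsetsLoop {m k τ : ℕ} {S : Fin k → Fin τ → Fin m} :
    S ∈ (disjointSubsetsLoop m k τ).val ↔
      (∀ j, StrictMono (S j)) ∧ ∀ j l, j ≠ l → ∀ a b, S j a ≠ S l b := by
  simp only [disjointSubsetsLoop, Timed.val_bind, Timed.select, List.mem_filter,
    Timed.mem_tuples, mem_subsetsLoop, Timed.allLoop, decide_eq_true_eq]
  grind

/-! ### Optimality of the selected bit tuples -/

section Best

variable {n d k τ : ℕ}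

/-- In every coordinate, the centers `C` take a tuple of the relation that has the least number of
weighted mismatches with the samples `V`. -/
structure IsBest (J : ConstrainedInstance n d k) (w : Fin k → ℝ) (V : Fin k → Fin τ → Point d)
    (C : Centers k d) : Prop where
  satisfies : J.Satisfies C
  le : ∀ i, ∀ b ∈ J.rel i, ∑ j, w j * ∑ t, neq (V j t i) (C j i)
    ≤ ∑ j, w j * ∑ t, neq (V j t i) (b j)

lemma exists_isBest (J : ConstrainedInstance n d k) (hJ : ∀ i, (J.rel i).Nonempty)
    (w : Fin k → ℝ) (V : Fin k → Fin τ → Point d) : ∃ C, IsBest J w V C := by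
  choose b hb hmin using fun i => Finset.exists_min_image (J.rel i)
    (fun b => ∑ j, w j * ∑ t, neq (V j t i) (b j)) (hJ i)
  exact ⟨fun j i => b i j, hb, hmin⟩

lemma isBest_bestCenters {m : ℕ} (J : ConstrainedInstance n d k)
    (hJ : ∀ i, (J.rel i).Nonempty) (M : Fin m → Point d) (S : Fin k → Fin τ → Fin m)
    (w : Fin k → ℝ) : IsBest J w (fun j t => M (S j t)) (bestCenters J M S w).val := by
  have key : ∀ i, ∃ b ∈ J.rel i, (fun j => (bestCenters J M S w).val j i) = b ∧
      ∀ b' ∈ J.rel i, ∑ j, w j * ∑ t, neq (M (S j t) i) (b j)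
        ≤ ∑ j, w j * ∑ t, neq (M (S j t) i) (b' j) := by
    intro i
    obtain ⟨b, hb⟩ : ∃ b, b ∈ List.argmin (fun b : Fin k → Bool =>
        ∑ j, w j * ∑ t, neq (M (S j t) i) (b j)) (J.rel i).toList := by
      simp only [Option.mem_def]
      rw [← Option.isSome_iff_exists, Option.isSome_iff_ne_none, Ne, List.argmin_eq_none,
        Finset.toList_eq_nil]
      exact (hJ i).ne_empty
    refine ⟨b, by simpa using List.argmin_mem hb, ?_, fun b' hb' =>
      List.le_of_mem_argmin (f := fun b : Fin k → Bool =>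
        ∑ j, w j * ∑ t, neq (M (S j t) i) (b j)) (by simpa using hb') hb⟩
    have : (fun j => (bestCenters J M S w).val j i) = (List.argmin (fun b : Fin k → Bool =>
        ∑ j, w j * ∑ t, neq (M (S j t) i) (b j)) (J.rel i).toList).getD fun _ => false := rfl
    rw [this, Option.mem_def.1 hb]
    rfl
  choose b hb hval hmin using key
  refine ⟨fun i => by rw [hval]; exact hb i, fun i b' hb' => ?_⟩
  have h := hmin i b' hb'
  rw [← hval i] at h
  exact h

end Best

/-! ### Candidates of one round -/

section Round

variable {n d k : ℕ}

/-- The candidates of one round, for given draws. -/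
def roundCandidates (J : ConstrainedInstance n d k) (B : Centers k d) (W : List ℝ) (τ η : ℕ)
    (O : Fin (η * k) → Fin n) : Timed (List (Centers k d)) := do
  let M ← sampleArray J.points B τ O
  let families ← disjointSubsetsLoop (η * k + k * (τ * k)) k τ
  let ws ← Timed.tuples k W
  Timed.collectMany (fun S => Timed.collect (fun w => bestCenters J M S w) ws) families

lemma mem_roundCandidates {J : ConstrainedInstance n d k} {B : Centers k d} {W : List ℝ}
    {τ η : ℕ} {O : Fin (η * k) → Fin n} {C : Centers k d} :
    C ∈ (roundCandidates J B W τ η O).val ↔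
      ∃ S ∈ (disjointSubsetsLoop (η * k + k * (τ * k)) k τ).val, ∃ w : Fin k → ℝ,
        (∀ j, w j ∈ W) ∧ (bestCenters J (sampleArray J.points B τ O).val S w).val = C := by
  simp only [roundCandidates, Timed.val_bind, Timed.collectMany, Timed.collect, List.mem_flatMap,
    List.mem_map, Timed.mem_tuples]

lemma satisfies_of_mem_roundCandidates {J : ConstrainedInstance n d k}
    (hJ : ∀ i, (J.rel i).Nonempty) {B : Centers k d} {W : List ℝ}
    {τ η : ℕ} {O : Fin (η * k) → Fin n} {C : Centers k d}
    (hC : C ∈ (roundCandidates J B W τ η O).val) : J.Satisfies C := by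
  obtain ⟨S, -, w, -, rfl⟩ := mem_roundCandidates.1 hC
  exact (isBest_bestCenters J hJ _ S w).satisfies

/-- Every choice of disjoint samples in the array contributes a best list of centers. -/
lemma exists_mem_roundCandidates {J : ConstrainedInstance n d k}
    (hJ : ∀ i, (J.rel i).Nonempty) {B : Centers k d} {W : List ℝ}
    {τ η : ℕ} {O : Fin (η * k) → Fin n} {P : Fin k → Fin τ → Fin (η * k + k * (τ * k))}
    (hP : ∀ j l a b, P j a = P l b → j = l ∧ a = b) {w : Fin k → ℝ} (hw : ∀ j, w j ∈ W) :
    ∃ C ∈ (roundCandidates J B W τ η O).val,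
      IsBest J w (fun j t => (sampleArray J.points B τ O).val (P j t)) C := by
  have hcard : ∀ j, (Finset.univ.image (P j)).card = τ := fun j => by
    rw [Finset.card_image_of_injective _ fun a b h => (hP j j a b h).2]
    simp
  -- The algorithm lists subsets only in increasing order. Sorting `P j` is harmless because the
  -- mismatch counts are invariant under permutations of the sample.
  let S : Fin k → Fin τ → Fin (η * k + k * (τ * k)) := fun j =>
    (Finset.univ.image (P j)).orderEmbOfFin (hcard j)
  have hmem : ∀ j t, ∃ a, P j a = S j t := fun j t => by
    have := Finset.orderEmbOfFin_mem _ (hcard j) t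
    simpa only [Finset.mem_image, Finset.mem_univ, true_and] using this
  have hsum : ∀ j (g : Fin (η * k + k * (τ * k)) → ℝ), ∑ t, g (S j t) = ∑ t, g (P j t) := by
    intro j g
    rw [← Finset.sum_image (s := Finset.univ) (g := S j)
        fun a _ b _ h => ((Finset.univ.image (P j)).orderEmbOfFin (hcard j)).injective h,
      ← Finset.sum_image (s := Finset.univ) (g := P j) fun a _ b _ h => (hP j j a b h).2]
    congr 1
    exact Finset.image_orderEmbOfFin_univ _ _
  have hS : S ∈ (disjointSubsetsLoop (η * k + k * (τ * k)) k τ).val := by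
    refine mem_disjointSubsetsLoop.2 ⟨fun j => OrderEmbedding.strictMono _, fun j l hjl a b h => ?_⟩
    obtain ⟨a', ha⟩ := hmem j a
    obtain ⟨b', hb⟩ := hmem l b
    exact hjl (hP j l a' b' (by rw [ha, hb, h])).1
  refine ⟨_, mem_roundCandidates.2 ⟨S, hS, w, hw, rfl⟩, ?_⟩
  have h := isBest_bestCenters J hJ (sampleArray J.points B τ O).val S w
  refine ⟨h.satisfies, fun i b hb => ?_⟩
  have h2 := h.le i b hb
  have h3 : ∀ c : Fin k → Bool,
      ∑ j, w j * ∑ t, neq ((sampleArray J.points B τ O).val (S j t) i) (c j)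
      = ∑ j, w j * ∑ t, neq ((sampleArray J.points B τ O).val (P j t) i) (c j) := fun c =>
    Finset.sum_congr rfl fun j _ => by
      rw [hsum j fun p => neq ((sampleArray J.points B τ O).val p i) (c j)]
  rw [h3 b] at h2
  exact (h3 fun j => (bestCenters J (sampleArray J.points B τ O).val S w).val j i).symm.trans_le h2

lemma sampleArray_val_castAdd (X : Fin n → Point d) (B : Centers k d) (τ : ℕ) {N : ℕ}
    (O : Fin N → Fin n) (u : Fin N) :
    (sampleArray X B τ O).val (Fin.castAdd _ u) = X (O u) := by
  change (fun i => Fin.append (fun u => X (O u))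
    (fun q => B (finProdFinEquiv.symm q).1) (Fin.castAdd _ u) i) = _
  simp

lemma sampleArray_val_natAdd (X : Fin n → Point d) (B : Centers k d) (τ : ℕ) {N : ℕ}
    (O : Fin N → Fin n) (b : Fin k) (c : Fin (τ * k)) :
    (sampleArray X B τ O).val (Fin.natAdd _ (finProdFinEquiv (b, c))) = B b := by
  change (fun i => Fin.append (fun u => X (O u))
    (fun q => B (finProdFinEquiv.symm q).1) (Fin.natAdd _ (finProdFinEquiv (b, c))) i) = _
  simp only [Fin.append_right, Equiv.symm_apply_apply]

end Round

lemma mem_guesses {ε : ℝ} {n : ℕ} {zero : Bool} {x : ℝ} :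
    x ∈ (guesses ε n zero).val ↔ (zero = true ∧ x = 0) ∨
      ∃ t ≤ ⌈Real.logb (1 + ε / 2) n⌉₊, x = (1 + ε / 2) ^ t := by
  cases zero <;>
  simp [guesses, Timed.val_bind, Timed.op, Timed.collect, eq_comm]

/-- Every number up to `n` is approximated by a guess. -/
lemma exists_guess {ε : ℝ} (hε : 0 < ε) {n N : ℕ} (hN : 0 < N) (hNn : N ≤ n) (zero : Bool) :
    ∃ x ∈ (guesses ε n zero).val, (N : ℝ) ≤ x ∧ x ≤ (1 + ε / 2) * N := by
  have hb : 1 < 1 + ε / 2 := by linarith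
  have hN' : (1 : ℝ) ≤ N := by exact_mod_cast hN
  have hlog : 0 ≤ Real.logb (1 + ε / 2) N := Real.logb_nonneg hb hN'
  have hpow : (1 + ε / 2) ^ (Real.logb (1 + ε / 2) N) = (N : ℝ) :=
    Real.rpow_logb (by linarith) (by linarith) (by linarith)
  -- Rounding the exponent up costs less than one further factor `1 + ε / 2`.
  refine ⟨(1 + ε / 2) ^ ⌈Real.logb (1 + ε / 2) N⌉₊, mem_guesses.2 (Or.inr ⟨_, ?_, rfl⟩), ?_, ?_⟩
  · refine Nat.ceil_mono (Real.logb_le_logb_of_le hb (by linarith) (by exact_mod_cast hNn))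
  · rw [← Real.rpow_natCast]
    conv_lhs => rw [← hpow]
    exact Real.rpow_le_rpow_of_exponent_le hb.le (Nat.le_ceil _)
  · rw [← Real.rpow_natCast]
    conv_rhs => rw [← hpow, ← Real.rpow_one_add' (by linarith) (by linarith)]
    refine Real.rpow_le_rpow_of_exponent_le hb.le ?_
    linarith [Nat.ceil_lt_add_one hlog]

/-! ### One round succeeds with probability of order `ε` -/

section Nearest

variable {n d k : ℕ}

lemma exists_nearest [NeZero k] (C : Centers k d) (x : Point d) :
    ∃ j, hammingDist x (C j) = ⨅ j, hammingDist x (C j) :=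
  exists_eq_ciInf_of_finite

lemma nearest_le (C : Centers k d) (x : Point d) (j : Fin k) :
    ⨅ j, hammingDist x (C j) ≤ hammingDist x (C j) :=
  ciInf_le (OrderBot.bddBelow _) j

lemma cost_le_sum (C : Centers k d) (X : Fin n → Point d) (a : Fin n → Fin k) :
    cost C X ≤ ∑ i, hammingDist (X i) (C (a i)) :=
  Finset.sum_le_sum fun _ _ => nearest_le C _ _

lemma opt_le {J : ConstrainedInstance n d k} {C : Centers k d} (hC : J.Satisfies C) :
    J.opt ≤ cost C J.points :=
  Nat.sInf_le ⟨C, hC, rfl⟩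

lemma exists_optimal {J : ConstrainedInstance n d k} (hJ : ∀ i, (J.rel i).Nonempty) :
    ∃ C, J.Satisfies C ∧ cost C J.points = J.opt := by
  choose b hb using hJ
  exact Nat.sInf_mem (s := {v | ∃ C : Centers k d, J.Satisfies C ∧ cost C J.points = v})
    ⟨_, fun j i => b i j, hb, rfl⟩

lemma opt_unconstrained_le {J : ConstrainedInstance n d k} (hJ : ∀ i, (J.rel i).Nonempty) :
    (unconstrained k J.points).opt ≤ J.opt := by
  obtain ⟨C, -, hC⟩ := exists_optimal hJ
  rw [← hC]
  exact opt_le (J := unconstrained k J.points) fun _ => Finset.mem_univ _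

end Nearest

/-! ### Probabilities of the weighted draw -/

section WeightedLaw

variable {n : ℕ} [NeZero n]

/-- The probability with which an index is drawn. -/
def drawWeight (D : Fin n → ℕ) (i : Fin n) : ℝ := (weightedLaw D i).toReal

lemma isWeight_drawWeight (D : Fin n → ℕ) : IsWeight (drawWeight D) := by
  refine ⟨fun i => ENNReal.toReal_nonneg, ?_⟩
  simp only [drawWeight]
  rw [← ENNReal.toReal_sum fun i _ => PMF.apply_ne_top _ _, ← tsum_fintype (L := .unconditional _),
    PMF.tsum_coe]
  rfl

lemma drawWeight_eq (D : Fin n → ℕ) (h : 0 < ∑ i, D i) (i : Fin n) :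
    drawWeight D i = D i / ∑ i, (D i : ℝ) := by
  have h0 : ¬ ∑ i, (D i : ℝ≥0∞) = 0 := by
    rw [← Nat.cast_sum]
    exact_mod_cast h.ne'
  rw [drawWeight, weightedLaw, dif_neg h0, PMF.normalize_apply, tsum_fintype, ENNReal.toReal_mul,
    ENNReal.toReal_inv, ENNReal.toReal_sum fun i _ => ENNReal.natCast_ne_top _]
  simp [div_eq_mul_inv]

end WeightedLaw

/-! ### Uniform cluster samples and their simulation -/

section Round

variable {n d k : ℕ}

/-- The uniform weights on the fibre of `a` above `j` (on everything if the fibre is empty). -/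
def clusterWeight (a : Fin n → Fin k) (j : Fin k) (i : Fin n) : ℝ :=
  if (Finset.univ.filter fun i => a i = j).card = 0 then 1 / n
  else if a i = j then 1 / ((Finset.univ.filter fun i => a i = j).card : ℝ) else 0

lemma isWeight_clusterWeight [NeZero n] (a : Fin n → Fin k) (j : Fin k) : IsWeight (clusterWeight a j) := by
  unfold clusterWeight
  split_ifs with h
  · refine ⟨fun i => by positivity, ?_⟩
    have : (n : ℝ) ≠ 0 := Nat.cast_ne_zero.2 (NeZero.ne n)
    simp [this]
  · refine ⟨fun i => by positivity, ?_⟩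
    have : ((Finset.univ.filter fun i => a i = j).card : ℝ) ≠ 0 := by exact_mod_cast h
    rw [← Finset.sum_filter, Finset.sum_const, nsmul_eq_mul]
    field_simp

lemma card_mul_sum_clusterWeight (a : Fin n → Fin k) (j : Fin k) (g : Fin n → ℝ) :
    ((Finset.univ.filter fun i => a i = j).card : ℝ) * ∑ i, clusterWeight a j i * g i
      = ∑ i with a i = j, g i := by
  unfold clusterWeight
  split_ifs with h
  · rw [h, Finset.card_eq_zero.1 h]; simp
  · have : ((Finset.univ.filter fun i => a i = j).card : ℝ) ≠ 0 := by exact_mod_cast h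
    simp only [ite_mul, zero_mul]
    rw [← Finset.sum_filter, ← Finset.mul_sum]
    field_simp

/-- Each nonempty cluster contributes exactly 1, and there are at most `k` of them. -/
lemma sum_inv_card_le (a : Fin n → Fin k) :
    ∑ i, (1 : ℝ) / (Finset.univ.filter fun i' => a i' = a i).card ≤ k := by
  have h1 : ∑ i, (1 : ℝ) / (Finset.univ.filter fun i' => a i' = a i).card
      = ∑ j : Fin k, ∑ i with a i = j, (1 : ℝ) / (Finset.univ.filter fun i' => a i' = j).card := by
    rw [← Finset.sum_fiberwise (s := Finset.univ) (g := a)]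
    refine Finset.sum_congr rfl fun j _ => Finset.sum_congr rfl fun i hi => ?_
    rw [(Finset.mem_filter.1 hi).2]
  rw [h1]
  calc _ ≤ ∑ _j : Fin k, (1 : ℝ) := by
        refine Finset.sum_le_sum fun j _ => ?_
        rw [Finset.sum_const, nsmul_eq_mul, mul_one_div]
        exact div_self_le_one _
    _ = k := by simp

/-- Outcomes of the draws for which the round finds a good list of centers. -/
def RoundGood (J : ConstrainedInstance n d k) (B : Centers k d) (W : List ℝ) (ε : ℝ) (τ η : ℕ)
    (O : Fin (η * k) → Fin n) : Prop :=
  ∃ C ∈ (roundCandidates J B W τ η O).val, (cost C J.points : ℝ) ≤ (1 + ε) * J.opt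

set_option maxHeartbeats 400000 in
/-- If points `Y j i` differ little from the points `X i`, samples of the points `Y j i` of each
cluster lead with probability at least `ε / 6` to centers of cost at most `(1 + ε) * opt`. -/
lemma prodExpect_isBest [NeZero n] {J : ConstrainedInstance n d k} (hJ : ∀ i, (J.rel i).Nonempty)
    {Cs : Centers k d} (hCs : J.Satisfies Cs) {a : Fin n → Fin k}
    (ha : ∑ i, hammingDist (J.points i) (Cs (a i)) = J.opt) {ε : ℝ} (hε : 0 < ε)
    (hε' : ε ≤ 1 / 2) {τ : ℕ} (hτ : 6400 / ε ^ 2 ≤ τ) {w : Fin k → ℝ}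
    (hw : ∀ j, ((Finset.univ.filter fun i => a i = j).card : ℝ) ≤ w j)
    (hw' : ∀ j, w j ≤ (1 + ε / 2) * (Finset.univ.filter fun i => a i = j).card)
    (Y : Fin k → Fin n → Point d)
    (hY : ∑ i, (hammingDist (J.points i) (Y (a i) i) : ℝ) ≤ ε / 64 * J.opt) :
    ε / 6 ≤ prodExpect (fun r : Fin k × Fin τ => clusterWeight a r.1) (fun S =>
      ind (∀ C, IsBest J w (fun j t => Y j (S (j, t))) C →
        (cost C J.points : ℝ) ≤ (1 + ε) * J.opt)) := by
  -- Ties among best tuples may be broken in any way, so `Ch S` is taken to be a best list that is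
  -- too expensive whenever one exists.
  have hex : ∀ S : Fin k × Fin τ → Fin n, ∃ C, IsBest J w (fun j t => Y j (S (j, t))) C ∧
      ((cost C J.points : ℝ) ≤ (1 + ε) * J.opt →
        ∀ C, IsBest J w (fun j t => Y j (S (j, t))) C →
          (cost C J.points : ℝ) ≤ (1 + ε) * J.opt) := by
    intro S
    by_cases h : ∀ C, IsBest J w (fun j t => Y j (S (j, t))) C →
          (cost C J.points : ℝ) ≤ (1 + ε) * J.opt
    · obtain ⟨C, hC⟩ := exists_isBest J hJ w (fun j t => Y j (S (j, t)))
      exact ⟨C, hC, fun _ => h⟩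
    · push Not at h
      obtain ⟨C, hC, hlt⟩ := h
      exact ⟨C, hC, fun hle => absurd hle hlt.not_ge⟩
  choose Ch hbest hworst using hex
  have hu := isWeight_clusterWeight (n := n) a
  let v : Fin k × Fin τ → Fin n → ℝ := fun r => clusterWeight a r.1
  have hv : ∀ r, IsWeight (v r) := fun r => hu r.1
  suffices h : prodExpect v (fun S => (cost (Ch S) J.points : ℝ)) ≤ (1 + 3 / 4 * ε) * J.opt by
    refine (prodExpect_markov v hv _ (fun S => Nat.cast_nonneg (cost (Ch S) J.points))
      (Nat.cast_nonneg J.opt) hε hε' h).trans ?_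
    exact prodExpect_mono v hv fun S => ind_mono (hworst S)
  have hw0 : ∀ j, 0 ≤ w j := fun j => (Nat.cast_nonneg _).trans (hw j)
  have hτ0 : 0 < τ := by
    have : (0 : ℝ) < τ := lt_of_lt_of_le (by positivity) hτ
    exact_mod_cast this
  set Δ : ℝ := ∑ i, (hammingDist (J.points i) (Y (a i) i) : ℝ) with hΔ
  have hfib : ∀ C : Centers k d, ∑ i, (hammingDist (Y (a i) i) (C (a i)) : ℝ)
      = ∑ j, ((Finset.univ.filter fun i => a i = j).card : ℝ) *
          ∑ i, clusterWeight a j i * hammingDist (Y j i) (C j) := by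
    intro C
    simp_rw [card_mul_sum_clusterWeight]
    rw [← Finset.sum_fiberwise (s := Finset.univ) (g := a)]
    refine Finset.sum_congr rfl fun j _ => Finset.sum_congr rfl fun i hi => ?_
    rw [(Finset.mem_filter.1 hi).2]
  have hin0 : ∀ (C : Centers k d) j,
      0 ≤ ∑ i, clusterWeight a j i * (hammingDist (Y j i) (C j) : ℝ) := fun C j =>
    Finset.sum_nonneg fun i _ => mul_nonneg ((hu j).nonneg i) (Nat.cast_nonneg _)
  have hcost : ∀ S, (cost (Ch S) J.points : ℝ)
      ≤ ∑ j, w j * ∑ i, clusterWeight a j i * hammingDist (Y j i) (Ch S j) + Δ := by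
    intro S
    have h1 : (cost (Ch S) J.points : ℝ)
        ≤ ∑ i, (hammingDist (J.points i) (Ch S (a i)) : ℝ) := by
      exact_mod_cast cost_le_sum (Ch S) J.points a
    have h2 : ∑ i, (hammingDist (J.points i) (Ch S (a i)) : ℝ)
        ≤ ∑ i, ((hammingDist (Y (a i) i) (Ch S (a i)) : ℝ)
          + hammingDist (J.points i) (Y (a i) i)) :=
      Finset.sum_le_sum fun i _ => by
        rw [add_comm]
        exact_mod_cast hammingDist_triangle _ _ _
    rw [Finset.sum_add_distrib, hfib] at h2
    refine (h1.trans h2).trans (add_le_add ?_ le_rfl)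
    exact Finset.sum_le_sum fun j _ => mul_le_mul_of_nonneg_right (hw j) (hin0 _ j)
  have hstar : ∑ j, w j * ∑ i, clusterWeight a j i * (hammingDist (Y j i) (Cs j) : ℝ)
      ≤ (1 + ε / 2) * (J.opt + Δ) := by
    have h1 : ∑ j, w j * ∑ i, clusterWeight a j i * (hammingDist (Y j i) (Cs j) : ℝ)
        ≤ (1 + ε / 2) * ∑ i, (hammingDist (Y (a i) i) (Cs (a i)) : ℝ) := by
      rw [hfib, Finset.mul_sum]
      refine Finset.sum_le_sum fun j _ => ?_
      rw [← mul_assoc]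
      exact mul_le_mul_of_nonneg_right (hw' j) (hin0 _ j)
    refine h1.trans (mul_le_mul_of_nonneg_left ?_ (by linarith))
    rw [← ha, hΔ, Nat.cast_sum, ← Finset.sum_add_distrib]
    refine Finset.sum_le_sum fun i _ => ?_
    rw [add_comm, hammingDist_comm (J.points i) (Y (a i) i)]
    exact_mod_cast hammingDist_triangle _ _ _
  have hbestE := prodExpect_best (clusterWeight a) hu hτ0 Y w hw0 Cs Ch
    (fun S i => (hbest S).le i _ (hCs i)) (κ := ε / 64) (by positivity)
  -- With `κ = ε / 64`, the bound on `τ` gives `κ * τ ≥ 100 / ε`, so the bias and the variance term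
  -- are each at most `ε / 32`.
  have hcoef : 2 * (ε / 64) + (1 + ε / 64) ^ 2 / (ε / 64 * τ) ≤ ε / 16 := by
    have h1 : (1 + ε / 64) ^ 2 / (ε / 64 * τ) ≤ ε / 32 := by
      rw [div_le_iff₀ (by positivity)]
      rw [div_le_iff₀ (by positivity)] at hτ
      nlinarith
    linarith
  have hO : (0 : ℝ) ≤ J.opt := Nat.cast_nonneg _
  have hΔ0 : 0 ≤ Δ := Finset.sum_nonneg fun i _ => Nat.cast_nonneg _
  calc prodExpect v (fun S => (cost (Ch S) J.points : ℝ))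
      ≤ prodExpect v (fun S =>
          ∑ j, w j * ∑ i, clusterWeight a j i * hammingDist (Y j i) (Ch S j) + Δ) :=
        prodExpect_mono v hv hcost
    _ ≤ (1 + ε / 16) * ((1 + ε / 2) * (J.opt + Δ)) + Δ := by
        rw [prodExpect_add, prodExpect_const v hv]
        refine add_le_add (hbestE.trans ?_) le_rfl
        refine mul_le_mul (by linarith) hstar
          (Finset.sum_nonneg fun j _ => mul_nonneg (hw0 j) (hin0 _ j)) (by linarith)
    _ ≤ (1 + ε / 16) * ((1 + ε / 2) * (J.opt + ε / 64 * J.opt)) + ε / 64 * J.opt := by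
        gcongr
    _ = ((1 + ε / 16) * ((1 + ε / 2) * (1 + ε / 64)) + ε / 64) * J.opt := by ring
    _ ≤ (1 + 3 / 4 * ε) * J.opt := by
        refine mul_le_mul_of_nonneg_right ?_ hO
        nlinarith [mul_pos hε hε, mul_pos (mul_pos hε hε) hε]

-- Combines the analysis of ideal cluster samples with their simulation: far points come from the
-- draws, near ones from the copies of `B`. The simulation costs a factor 2, which turns `ε / 6`
-- into `ε / 12`.
set_option maxHeartbeats 400000 in
lemma prodExpect_roundGood [NeZero n] [NeZero k] {J : ConstrainedInstance n d k} (hJ : ∀ i, (J.rel i).Nonempty)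
    {B : Centers k d} {α : ℝ} (hα : 1 ≤ α) (hB : IsApproxSolution α J.points B) {ε : ℝ}
    (hε : 0 < ε) (hε' : ε ≤ 1 / 2) {zero : Bool} (hfull : zero = true ∨ J.HasFullOptimum)
    {τ η : ℕ} (hτ : 6400 / ε ^ 2 ≤ τ) (hτk : 2 * k ≤ τ)
    (hη : 512 * (τ * α * k / ε) ≤ η) :
    ε / 12 ≤ prodExpect
      (fun _ => drawWeight fun i => (nearestLoop B (J.points i)).val)
      (fun O => ind (RoundGood J B (guesses ε n zero).val ε τ η O)) := by
  set D : Fin n → ℕ := fun i => (nearestLoop B (J.points i)).val with hD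
  have hDnear : ∀ i, D i = ⨅ j, hammingDist (J.points i) (B j) := fun i => by
    simp only [hD, nearestLoop, Timed.minLoop]
    refine iInf_congr fun j => ?_
    simp only [distLoop, Timed.sumLoop, Timed.val_bind, Timed.op, hammingDist]
    rw [Finset.card_filter]
  clear_value D
  have hk : (1 : ℝ) ≤ k := by exact_mod_cast NeZero.one_le
  have hΦ : (∑ i, (D i : ℝ)) ≤ α * J.opt := by
    have h1 : (cost B J.points : ℝ) = ∑ i, (D i : ℝ) := by
      rw [cost, Nat.cast_sum]
      exact Finset.sum_congr rfl fun i _ => by rw [hDnear]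
    rw [← h1]
    refine hB.trans (mul_le_mul_of_nonneg_left ?_ (by linarith))
    exact_mod_cast opt_unconstrained_le hJ
  obtain ⟨Cs, hCs, hopt, a, hnear, hsurj⟩ : ∃ Cs, J.Satisfies Cs ∧ cost Cs J.points = J.opt ∧
      ∃ a : Fin n → Fin k,
        (∀ i, hammingDist (J.points i) (Cs (a i)) = ⨅ j, hammingDist (J.points i) (Cs j)) ∧
        (zero = true ∨ Function.Surjective a) := by
    rcases hfull with hz | ⟨C, hC, hopt, a, hsurj, hle⟩
    · obtain ⟨C, hC, hopt⟩ := exists_optimal hJ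
      choose a ha using fun i => exists_nearest C (J.points i)
      exact ⟨C, hC, hopt, a, ha, Or.inl hz⟩
    · exact ⟨C, hC, hopt, a, fun i => le_antisymm (le_ciInf (hle i)) (nearest_le _ _ _),
        Or.inr hsurj⟩
  have ha : ∑ i, hammingDist (J.points i) (Cs (a i)) = J.opt := by
    rw [← hopt, cost]
    exact Finset.sum_congr rfl fun i _ => hnear i
  let N : Fin k → ℕ := fun j => (Finset.univ.filter fun i => a i = j).card
  have hNpos : ∀ i, 0 < N (a i) := fun i => Finset.card_pos.2 ⟨i, by simp⟩
  -- An empty cluster forces the weight 0, which is why either the guess 0 or an optimum without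
  -- empty clusters is needed.
  have hwex : ∀ j, ∃ x ∈ (guesses ε n zero).val, (N j : ℝ) ≤ x ∧ x ≤ (1 + ε / 2) * N j := by
    intro j
    rcases (N j).eq_zero_or_pos with h0 | h0
    · rcases hsurj with hz | hs
      · exact ⟨0, mem_guesses.2 (Or.inl ⟨hz, rfl⟩), by simp [h0], by simp [h0]⟩
      · obtain ⟨i, rfl⟩ := hs j
        exact absurd h0 (hNpos i).ne'
    · exact exists_guess hε h0 ((Finset.card_le_univ _).trans (by simp)) zero
  choose w hwmem hw hw' using hwex
  choose b hb using fun i => exists_nearest B (J.points i)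
  -- Chosen so that near points, costing at most `p * ∑ D` in each of `k` clusters, cost together at
  -- most `ε / 64 * opt`.
  set p : ℝ := ε / 64 / (k * α) with hp
  have hp0 : 0 < p := by positivity
  have hpk : p * (α * J.opt) * k = ε / 64 * J.opt := by
    rw [hp]
    field_simp
  have hp1 : p < 1 := by
    rw [hp, div_lt_one (by positivity)]
    nlinarith
  -- After division this says `p / N j < D i / ∑ D`: the draw hits `i` with more than `p` times its
  -- uniform probability in the cluster.
  let far : Fin k → Fin n → Prop := fun j i => a i = j ∧ p * ∑ i, (D i : ℝ) < D i * N j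
  classical
  let Y : Fin k → Fin n → Point d := fun j i => if far j i then J.points i else B (b i)
  have hΦ0 : 0 ≤ ∑ i, (D i : ℝ) := Finset.sum_nonneg fun i _ => Nat.cast_nonneg _
  have hY : ∑ i, (hammingDist (J.points i) (Y (a i) i) : ℝ) ≤ ε / 64 * J.opt := by
    have h1 : ∀ i, (hammingDist (J.points i) (Y (a i) i) : ℝ)
        ≤ p * (∑ i, (D i : ℝ)) * (1 / N (a i)) := by
      intro i
      have hN : (0 : ℝ) < N (a i) := by exact_mod_cast hNpos i
      by_cases h : far (a i) i
      · have hYi : Y (a i) i = J.points i := if_pos h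
        rw [hYi, hammingDist_self, Nat.cast_zero]
        exact mul_nonneg (mul_nonneg hp0.le hΦ0) (one_div_nonneg.2 hN.le)
      · have hYi : Y (a i) i = B (b i) := if_neg h
        rw [hYi, hb, ← hDnear]
        simp only [far, true_and, not_lt] at h
        rw [mul_one_div, le_div_iff₀ hN]
        exact h
    refine (Finset.sum_le_sum fun i _ => h1 i).trans ?_
    rw [← Finset.mul_sum]
    calc p * (∑ i, (D i : ℝ)) * ∑ i, 1 / (N (a i) : ℝ)
        ≤ p * (α * J.opt) * k :=
          mul_le_mul (mul_le_mul_of_nonneg_left hΦ hp0.le) (sum_inv_card_le a)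
            (Finset.sum_nonneg fun i _ => one_div_nonneg.2 (Nat.cast_nonneg _))
            (mul_nonneg hp0.le (hΦ0.trans hΦ))
      _ = ε / 64 * J.opt := hpk
  have hfar : ∀ j y, far j y → p * clusterWeight a j y ≤ drawWeight D y := by
    rintro j y ⟨rfl, hy⟩
    have hN : (0 : ℝ) < N (a y) := by exact_mod_cast hNpos y
    have hpos : 0 < ∑ i, D i := by
      rw [Nat.pos_iff_ne_zero]
      intro h
      have h0 := (Finset.sum_eq_zero_iff.1 h) y (Finset.mem_univ y)
      rw [h0] at hy
      simp only [Nat.cast_zero, zero_mul] at hy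
      exact absurd hy (not_lt.2 (mul_nonneg hp0.le hΦ0))
    have hpos' : (0 : ℝ) < ∑ i, (D i : ℝ) := by exact_mod_cast hpos
    rw [drawWeight_eq D hpos, clusterWeight, if_neg (hNpos y).ne', if_pos rfl, mul_one_div,
      div_le_div_iff₀ hN hpos']
    exact hy.le
  have hu := isWeight_clusterWeight (n := n) a
  let slot : Fin k × Fin η ≃ Fin (η * k) := (Equiv.prodComm _ _).trans finProdFinEquiv
  let G : (Fin k × Fin τ → Fin n) → Prop := fun S =>
    ∀ C, IsBest J w (fun j t => Y j (S (j, t))) C → (cost C J.points : ℝ) ≤ (1 + ε) * J.opt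
  have hsim := prodExpect_simulation (η := η) (τ := τ) (drawWeight D) (isWeight_drawWeight D)
    (clusterWeight a) hu far hp0.le hp1 hfar
    (fun z => RoundGood J B (guesses ε n zero).val ε τ η (z ∘ slot.symm)) G (by
      intro z S e hz hG
      -- Every pair `(j, t)` owns one copy of each center of `B`, so the positions stay distinct
      -- even if all sampled points are near the same center.
      let P : Fin k → Fin τ → Fin (η * k + k * (τ * k)) := fun j t =>
        if far j (S (j, t)) then Fin.castAdd _ (slot (j, e j t))
        else Fin.natAdd _ (finProdFinEquiv (b (S (j, t)), finProdFinEquiv (t, j)))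
      have hP : ∀ j l x y, P j x = P l y → j = l ∧ x = y := by
        intro j l x y h
        simp only [P] at h
        split_ifs at h with h1 h2 h2
        · have := slot.injective (Fin.castAdd_injective _ _ h)
          simp only [Prod.mk.injEq] at this
          obtain ⟨rfl, h⟩ := this
          exact ⟨rfl, (e j).injective h⟩
        · simp only [Fin.ext_iff, Fin.val_castAdd, Fin.val_natAdd] at h
          have := (slot (j, e j x)).isLt
          omega
        · simp only [Fin.ext_iff, Fin.val_castAdd, Fin.val_natAdd] at h
          have := (slot (l, e l y)).isLt
          omega
        · have := finProdFinEquiv.injective (Fin.natAdd_injective _ _ h)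
          simp only [Prod.mk.injEq] at this
          have := finProdFinEquiv.injective this.2
          simp only [Prod.mk.injEq] at this
          exact this.symm
      obtain ⟨C, hC, hbest⟩ := exists_mem_roundCandidates hJ (B := B)
        (O := z ∘ slot.symm) hP hwmem
      refine ⟨C, hC, hG C ?_⟩
      have hval : (fun j t => (sampleArray J.points B τ (z ∘ slot.symm)).val (P j t))
          = fun j t => Y j (S (j, t)) := by
        funext j t
        by_cases h : far j (S (j, t))
        · simp only [P, Y, if_pos h, sampleArray_val_castAdd, Function.comp,
            Equiv.symm_apply_apply, hz j t h]
        · simp only [P, Y, if_neg h, sampleArray_val_natAdd]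
      rwa [hval] at hbest)
  have hreindex := prodExpect_comp (fun _ : Fin k × Fin η => drawWeight D)
    (fun _ => isWeight_drawWeight D) slot.symm.injective
    (fun O => ind (RoundGood J B (guesses ε n zero).val ε τ η O))
  rw [← hreindex]
  refine le_trans ?_ hsim
  have hgood : ε / 6 ≤ prodExpect (fun r => clusterWeight a r.1) (fun S => ind (G S)) :=
    prodExpect_isBest hJ hCs ha hε hε' hτ hw hw' Y hY
  -- The lower bound on `η` yields `p * η ≥ 8 * τ`. So a block fails with probability at most `exp τ
  -- * exp (-4 * τ) ≤ exp (-τ)`, and `2 * k ≤ τ` pays for the union over the blocks.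
  have hfail : k * (2 ^ τ * (1 - p / 2) ^ η) ≤ (1 / 2 : ℝ) := by
    have hpη : 8 * (τ : ℝ) ≤ p * η := by
      have : p * (512 * (τ * α * k / ε)) = 8 * τ := by
        rw [hp]
        field_simp
        ring
      rw [← this]
      gcongr
    have h1 : (1 - p / 2) ^ η ≤ Real.exp (-(4 * τ)) := by
      calc (1 - p / 2) ^ η ≤ Real.exp (-(p / 2)) ^ η := by
            refine pow_le_pow_left₀ (by linarith) ?_ η
            linarith [Real.add_one_le_exp (-(p / 2))]
        _ = Real.exp (η * -(p / 2)) := (Real.exp_nat_mul _ _).symm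
        _ ≤ _ := Real.exp_le_exp.2 (by linarith)
    have h2 : (2 : ℝ) ^ τ ≤ Real.exp τ := by
      rw [← mul_one (τ : ℝ), Real.exp_nat_mul]
      exact pow_le_pow_left₀ (by norm_num) (by linarith [Real.add_one_le_exp (1 : ℝ)]) τ
    have h3 : (2 : ℝ) ^ τ * (1 - p / 2) ^ η ≤ Real.exp (-τ) := by
      calc (2 : ℝ) ^ τ * (1 - p / 2) ^ η ≤ Real.exp τ * Real.exp (-(4 * τ)) := by
            gcongr
            exact pow_nonneg (by linarith) _
        _ = Real.exp (τ + -(4 * τ)) := (Real.exp_add _ _).symm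
        _ ≤ _ := Real.exp_le_exp.2 (by linarith [Nat.cast_nonneg (α := ℝ) τ])
    have h4 : 2 * (k : ℝ) ≤ Real.exp τ := by
      have : 2 * (k : ℝ) ≤ τ := by exact_mod_cast hτk
      linarith [Real.add_one_le_exp (τ : ℝ)]
    calc k * (2 ^ τ * (1 - p / 2) ^ η) ≤ k * Real.exp (-τ) := by gcongr
      _ ≤ 1 / 2 := by
        rw [Real.exp_neg, mul_inv_le_iff₀ (Real.exp_pos _)]
        linarith
  calc ε / 12 = 1 / 2 * (ε / 6) := by ring
    _ ≤ _ := mul_le_mul (by linarith) hgood (by positivity) (by linarith)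

end Round

/-! ### Laws and outcomes of randomized computations -/

namespace Rand

variable {α β : Type}

/-- The law of the result. -/
def valLaw (p : Rand α) : PMF α := p.law.map Timed.val

lemma prob_eq (p : Rand α) (E : α → Prop) : p.prob E = p.valLaw.toOuterMeasure {a | E a} := by
  rw [valLaw, PMF.toOuterMeasure_map_apply]
  rfl

lemma valLaw_bind (p : Rand α) (f : α → Rand β) :
    (p >>= f).valLaw = p.valLaw.bind fun a => (f a).valLaw := by
  change PMF.map Timed.val (p.law.bind fun x =>
    (f x.val).law.map fun y => ⟨y.val, x.steps + y.steps⟩) = _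
  rw [PMF.map_bind, valLaw, PMF.bind_map]
  congr 1
  funext x
  rw [PMF.map_comp]
  rfl

lemma valLaw_lift (x : Timed α) : (lift x).valLaw = PMF.pure x.val := PMF.pure_map _ _

lemma valLaw_lift_bind (x : Timed α) (f : α → Rand β) :
    (lift x >>= f).valLaw = (f x.val).valLaw := by
  rw [valLaw_bind, valLaw_lift, PMF.pure_bind]

lemma valLaw_bind_lift (p : Rand α) (f : α → Timed β) :
    (p >>= fun a => lift (f a)).valLaw = p.valLaw.map fun a => (f a).val := by
  rw [valLaw_bind]
  simp_rw [valLaw_lift]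
  rfl

lemma valLaw_replicate_succ (m : ℕ) (p : Rand α) :
    (replicate (m + 1) p).valLaw = p.valLaw.bind fun a =>
      (replicate m p).valLaw.map (Fin.cons (α := fun _ => α) a) := by
  rw [replicate, valLaw_bind]
  congr 1
  funext a
  rw [valLaw_bind_lift]

lemma valLaw_replicate_apply (p : Rand α) : ∀ (m : ℕ) (t : Fin m → α),
    (replicate m p).valLaw t = ∏ i, p.valLaw (t i)
  | 0, t => by
    rw [replicate, valLaw_lift, PMF.pure_apply, if_pos (funext fun i => i.elim0)]
    simp
  | m + 1, t => by
    classical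
    rw [valLaw_replicate_succ, PMF.bind_apply, Fin.prod_univ_succ, tsum_eq_single (t 0)]
    · rw [PMF.map_apply, tsum_eq_single (Fin.tail t), if_pos (Fin.cons_self_tail t).symm,
        valLaw_replicate_apply p m]
      · rfl
      · intro s hs
        rw [if_neg]
        intro h
        exact hs (by rw [h, Fin.tail_cons])
    · intro a ha
      rw [PMF.map_apply, ENNReal.tsum_eq_zero.2, mul_zero]
      intro s
      rw [if_neg]
      intro h
      exact ha (by rw [h, Fin.cons_zero])

/-- Independence of the runs, by splitting off the first one. -/
lemma replicate_all_not (p : Rand α) (G : α → Prop) : ∀ m : ℕ,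
    (replicate m p).valLaw.toOuterMeasure {t | ∀ i, ¬G (t i)}
      = p.valLaw.toOuterMeasure {a | ¬G a} ^ m
  | 0 => by
    rw [pow_zero, replicate, valLaw_lift, PMF.toOuterMeasure_pure_apply, if_pos]
    exact fun i => i.elim0
  | m + 1 => by
    classical
    rw [valLaw_replicate_succ, PMF.toOuterMeasure_bind_apply, pow_succ',
      ← replicate_all_not p G m, PMF.toOuterMeasure_apply p.valLaw, ← ENNReal.tsum_mul_right]
    refine tsum_congr fun a => ?_
    rw [PMF.toOuterMeasure_map_apply]
    by_cases h : G a
    · rw [Set.indicator_of_notMem (by simpa using h), zero_mul]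
      have : Fin.cons a ⁻¹' {t : Fin (m + 1) → α | ∀ i, ¬G (t i)} = ∅ :=
        Set.eq_empty_of_forall_notMem fun t ht => ht 0 (by simpa using h)
      rw [this, MeasureTheory.measure_empty, mul_zero]
    · rw [Set.indicator_of_mem (by simpa using h)]
      congr 2
      ext t
      simp [Fin.forall_fin_succ, h]

end Rand

lemma toOuterMeasure_add_compl {α : Type} (q : PMF α) (s : Set α) :
    q.toOuterMeasure s + q.toOuterMeasure sᶜ = 1 := by
  rw [PMF.toOuterMeasure_apply, PMF.toOuterMeasure_apply, ← ENNReal.tsum_add, ← q.tsum_coe]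
  refine tsum_congr fun a => ?_
  exact congrFun (Set.indicator_self_add_compl s q) a

namespace Rand

/-- All outcomes of `p`, with their numbers of steps, have the property `Q`. -/
def All {α : Type} (p : Rand α) (Q : α → ℕ → Prop) : Prop := ∀ r ∈ p.outcomes, Q r.val r.steps

variable {α β : Type}

lemma all_lift {x : Timed α} {Q : α → ℕ → Prop} (h : Q x.val x.steps) : (lift x).All Q := by
  intro r hr
  rw [outcomes, lift, PMF.support_pure, Set.mem_singleton_iff] at hr
  rwa [hr]

lemma All.bind {p : Rand α} {f : α → Rand β} {P : α → ℕ → Prop} {Q : β → ℕ → Prop} (hp : p.All P)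
    (hf : ∀ a s, P a s → (f a).All fun b t => Q b (s + t)) : (p >>= f).All Q := by
  intro r hr
  change r ∈ (p.law.bind fun x =>
    (f x.val).law.map fun y => (⟨y.val, x.steps + y.steps⟩ : Timed β)).support at hr
  rw [PMF.mem_support_bind_iff] at hr
  obtain ⟨x, hx, hr⟩ := hr
  rw [PMF.mem_support_map_iff] at hr
  obtain ⟨y, hy, rfl⟩ := hr
  exact hf x.val x.steps (hp x hx) y hy

lemma All.mono {p : Rand α} {P Q : α → ℕ → Prop} (hp : p.All P) (h : ∀ a s, P a s → Q a s) :
    p.All Q := fun r hr => h _ _ (hp r hr)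

lemma All.replicate {p : Rand α} {P : α → Prop} {T : ℕ} (hp : p.All fun a s => P a ∧ s ≤ T) :
    ∀ m, (replicate m p).All fun t s => (∀ i, P (t i)) ∧ s ≤ 1 + m * (T + 2)
  | 0 => all_lift ⟨fun i => i.elim0, by simp [Timed.op]⟩
  | m + 1 => by
    refine hp.bind fun a s ⟨ha, hs⟩ => (All.replicate hp m).bind fun t s' ⟨ht, hs'⟩ =>
      all_lift ⟨fun i => ?_, ?_⟩
    · refine Fin.cases ?_ (fun i => ?_) i
      · simpa using ha
      · simpa using ht i
    · simp only
      have : (m + 1) * (T + 2) = m * (T + 2) + T + 2 := by ring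
      omega

end Rand

/-! ### The probability of success -/

section Success

variable {n d k : ℕ}

lemma valLaw_weightedDraw [NeZero n] (D : Fin n → ℕ) : (weightedDraw D).valLaw = weightedLaw D := by
  rw [weightedDraw, Rand.valLaw, PMF.map_comp]
  exact PMF.map_id _

lemma costLoop_val (C : Centers k d) (X : Fin n → Point d) : (costLoop C X).val = cost C X := by
  simp only [costLoop, nearestLoop, distLoop, Timed.sumLoop, Timed.minLoop, Timed.val_bind,
    Timed.op, cost, hammingDist, Finset.card_filter]

lemma samplingRound_eq [NeZero n] (J : ConstrainedInstance n d k) (B : Centers k d)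
    (D : Fin n → ℕ) (W : List ℝ) (τ η : ℕ) : samplingRound J B D W τ η =
      (Rand.replicate (η * k) (weightedDraw D) >>= fun O =>
        Rand.lift (roundCandidates J B W τ η O)) := rfl

/-- The final selection among the candidates of all rounds. -/
def selectBest {ζ : ℕ} (J : ConstrainedInstance n d k) (rounds : Fin ζ → List (Centers k d)) :
    Timed (Option (Centers k d)) := do
  let indices ← ⟨List.finRange ζ, ζ⟩
  let candidates ← Timed.collectMany (fun r => Timed.op (rounds r)) indices
  Timed.argminLoop (fun C => costLoop C J.points) candidates

lemma goodCenters_eq [NeZero n] (J : ConstrainedInstance n d k) (B : Centers k d) (ε : ℝ)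
    (zero : Bool) (τ η ζ : ℕ) : goodCenters J B ε zero τ η ζ =
      (Rand.lift (Timed.fill fun i => nearestLoop B (J.points i)) >>= fun D =>
        Rand.lift (guesses ε n zero) >>= fun W =>
          Rand.replicate ζ (samplingRound J B D W τ η) >>= fun rounds =>
            Rand.lift (selectBest J rounds)) := rfl

lemma selectBest_val {ζ : ℕ} (J : ConstrainedInstance n d k)
    (rounds : Fin ζ → List (Centers k d)) :
    (selectBest J rounds).val = ((List.finRange ζ).flatMap rounds).argmin
      fun C => cost C J.points := by
  simp only [selectBest, Timed.val_bind, Timed.collectMany, Timed.op, Timed.argminLoop,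
    costLoop_val]

/-- The final minimum makes a single good candidate, in whatever round, sufficient. -/
lemma exists_selectBest {ζ : ℕ} (J : ConstrainedInstance n d k)
    {rounds : Fin ζ → List (Centers k d)} {r : Fin ζ} {C : Centers k d} (hC : C ∈ rounds r) :
    ∃ E, (selectBest J rounds).val = some E ∧ (∃ r, E ∈ rounds r) ∧
      cost E J.points ≤ cost C J.points := by
  have hmem : C ∈ (List.finRange ζ).flatMap rounds :=
    List.mem_flatMap.2 ⟨r, List.mem_finRange r, hC⟩
  rw [selectBest_val]
  cases h : ((List.finRange ζ).flatMap rounds).argmin fun C => cost C J.points with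
  | none =>
    rw [List.argmin_eq_none] at h
    rw [h] at hmem
    exact absurd hmem List.not_mem_nil
  | some E =>
    refine ⟨E, rfl, ?_, List.le_of_mem_argmin (f := fun C => cost C J.points) hmem h⟩
    obtain ⟨r', -, hr'⟩ := List.mem_flatMap.1 (List.argmin_mem (f := fun C => cost C J.points) h)
    exact ⟨r', hr'⟩

/-- Passes from the finite real sums of the analysis to the law of the program. -/
lemma samplingRound_fail [NeZero n] (J : ConstrainedInstance n d k) (B : Centers k d)
    (D : Fin n → ℕ) (W : List ℝ) (ε : ℝ) (τ η : ℕ) {p : ℝ} (hp : 0 ≤ p)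
    (h : p ≤ prodExpect (fun _ => drawWeight D) (fun O => ind (RoundGood J B W ε τ η O))) :
    (samplingRound J B D W τ η).valLaw.toOuterMeasure
        {L | ¬∃ C ∈ L, (cost C J.points : ℝ) ≤ (1 + ε) * J.opt} ≤ ENNReal.ofReal (1 - p) := by
  have hgood : ENNReal.ofReal p ≤ (samplingRound J B D W τ η).valLaw.toOuterMeasure
        {L | ∃ C ∈ L, (cost C J.points : ℝ) ≤ (1 + ε) * J.opt} := by
    classical
    rw [samplingRound_eq, Rand.valLaw_bind_lift, PMF.toOuterMeasure_map_apply,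
      PMF.toOuterMeasure_apply_fintype]
    have : ∀ O : Fin (η * k) → Fin n, Set.indicator ((fun O => (roundCandidates J B W τ η O).val) ⁻¹'
          {L | ∃ C ∈ L, (cost C J.points : ℝ) ≤ (1 + ε) * J.opt})
        (Rand.replicate (η * k) (weightedDraw D)).valLaw O
        = ENNReal.ofReal ((∏ r, drawWeight D (O r)) * ind (RoundGood J B W ε τ η O)) := by
      intro O
      have hprod : (Rand.replicate (η * k) (weightedDraw D)).valLaw O
          = ENNReal.ofReal (∏ r, drawWeight D (O r)) := by
        rw [Rand.valLaw_replicate_apply, valLaw_weightedDraw,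
          ENNReal.ofReal_prod_of_nonneg fun r _ => (isWeight_drawWeight D).nonneg _]
        exact Finset.prod_congr rfl fun r _ =>
          (ENNReal.ofReal_toReal (PMF.apply_ne_top _ _)).symm
      by_cases hO : RoundGood J B W ε τ η O
      · rw [Set.indicator_of_mem (by exact hO), ind_of hO, mul_one, hprod]
      · rw [Set.indicator_of_notMem (by exact hO), ind_of_not hO, mul_zero, ENNReal.ofReal_zero]
    simp_rw [this]
    rw [← ENNReal.ofReal_sum_of_nonneg fun O _ => mul_nonneg
      (Finset.prod_nonneg fun r _ => (isWeight_drawWeight D).nonneg _) (ind_nonneg _)]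
    exact ENNReal.ofReal_le_ofReal h
  have hadd := toOuterMeasure_add_compl (samplingRound J B D W τ η).valLaw
    {L | ∃ C ∈ L, (cost C J.points : ℝ) ≤ (1 + ε) * J.opt}
  rw [ENNReal.ofReal_sub _ hp, ENNReal.ofReal_one, ← hadd]
  refine ENNReal.le_sub_of_add_le_left ENNReal.ofReal_ne_top ?_
  exact add_le_add hgood le_rfl

lemma goodCenters_prob [NeZero n] [NeZero k] {J : ConstrainedInstance n d k}
    (hJ : ∀ i, (J.rel i).Nonempty)
    {B : Centers k d} {α : ℝ} (hα : 1 ≤ α) (hB : IsApproxSolution α J.points B) {ε : ℝ}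
    (hε : 0 < ε) (hε' : ε ≤ 1 / 2) {zero : Bool} (hfull : zero = true ∨ J.HasFullOptimum)
    {τ η ζ : ℕ} (hτ : 6400 / ε ^ 2 ≤ τ) (hτk : 2 * k ≤ τ)
    (hη : 512 * (τ * α * k / ε) ≤ η) (hζ : 24 / ε ≤ ζ) :
    3 / 4 ≤ (goodCenters J B ε zero τ η ζ).prob fun out =>
      ∃ D, out = some D ∧ (cost D J.points : ℝ) ≤ (1 + ε) * J.opt := by
  set D : Fin n → ℕ := fun i => (nearestLoop B (J.points i)).val with hD
  set round := samplingRound J B D (guesses ε n zero).val τ η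
  have hfail : (Rand.replicate ζ round).valLaw.toOuterMeasure
      {t | ∀ i, ¬∃ C ∈ t i, (cost C J.points : ℝ) ≤ (1 + ε) * J.opt} ≤ 1 / 4 := by
    rw [Rand.replicate_all_not round
      fun L => ∃ C ∈ L, (cost C J.points : ℝ) ≤ (1 + ε) * J.opt]
    refine (pow_le_pow_left' (samplingRound_fail J B D _ ε τ η (p := ε / 12) (by positivity)
      (prodExpect_roundGood hJ hα hB hε hε' hfull hτ hτk hη)) ζ).trans ?_
    rw [← ENNReal.ofReal_pow (by linarith)]
    -- Here `ζ * ε / 12 ≥ 2`, and `exp 1 ≥ 2` already gives `exp (-2) ≤ 1 / 4`.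
    have h1 : (1 - ε / 12) ^ ζ ≤ (1 / 4 : ℝ) := by
      calc (1 - ε / 12) ^ ζ ≤ Real.exp (-(ε / 12)) ^ ζ :=
            pow_le_pow_left₀ (by linarith) (by linarith [Real.add_one_le_exp (-(ε / 12))]) ζ
        _ = Real.exp (ζ * -(ε / 12)) := (Real.exp_nat_mul _ _).symm
        _ ≤ Real.exp (-2) := by
            refine Real.exp_le_exp.2 ?_
            rw [div_le_iff₀ hε] at hζ
            linarith
        _ ≤ 1 / 4 := by
            rw [show (-2 : ℝ) = -((2 : ℕ) * 1) by norm_num, Real.exp_neg, Real.exp_nat_mul,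
              inv_le_comm₀ (by positivity) (by norm_num)]
            nlinarith [Real.add_one_le_exp (1 : ℝ)]
    refine (ENNReal.ofReal_le_ofReal h1).trans_eq ?_
    rw [ENNReal.ofReal_div_of_pos (by norm_num)]
    simp
  have hsub : (Rand.replicate ζ round).valLaw.toOuterMeasure
      {t | ∀ i, ¬∃ C ∈ t i, (cost C J.points : ℝ) ≤ (1 + ε) * J.opt}ᶜ
      ≤ (goodCenters J B ε zero τ η ζ).prob fun out =>
        ∃ D, out = some D ∧ (cost D J.points : ℝ) ≤ (1 + ε) * J.opt := by
    rw [Rand.prob_eq, goodCenters_eq, Rand.valLaw_lift_bind, Rand.valLaw_lift_bind,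
      Rand.valLaw_bind_lift, PMF.toOuterMeasure_map_apply]
    refine MeasureTheory.measure_mono fun t ht => ?_
    simp only [Set.mem_compl_iff, Set.mem_ofPred_eq, not_forall, not_not] at ht
    obtain ⟨i, C, hC, hcost⟩ := ht
    obtain ⟨E, hE, -, hle⟩ := exists_selectBest J hC
    refine ⟨E, hE, le_trans ?_ hcost⟩
    exact_mod_cast hle
  refine le_trans ?_ hsub
  have hadd := toOuterMeasure_add_compl (Rand.replicate ζ round).valLaw
    {t | ∀ i, ¬∃ C ∈ t i, (cost C J.points : ℝ) ≤ (1 + ε) * J.opt}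
  have h34 : (3 / 4 : ℝ≥0∞) = 1 - 1 / 4 := by
    refine (ENNReal.sub_eq_of_eq_add (by simp) ?_).symm
    rw [ENNReal.div_add_div_same]
    norm_num
    exact (ENNReal.div_self (by norm_num) (by norm_num)).symm
  calc (3 / 4 : ℝ≥0∞) = 1 - 1 / 4 := h34
    _ ≤ 1 - _ := tsub_le_tsub_left hfail 1
    _ ≤ _ := tsub_le_iff_left.2 hadd.ge

end Success

/-! ### Step counts -/

lemma sum_map_le {α : Type} (l : List α) (g : α → ℕ) {c N : ℕ} (hg : ∀ a ∈ l, g a ≤ c)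
    (hl : l.length ≤ N) : (l.map g).sum ≤ N * c := by
  have h := List.sum_le_card_nsmul (l.map g) c (by simpa using hg)
  rw [List.length_map, smul_eq_mul] at h
  exact h.trans (Nat.mul_le_mul_right c hl)

/-- One level of the recursion costs at most `(m + 8) * N ^ (m + 1)`, and the square in the bound
grows by `2 * m + 17`, which suffices for the induction. -/
lemma Timed.tuples_steps_le {α : Type} (l : List α) {N : ℕ} (hN : 1 ≤ N) (hl : l.length ≤ N) :
    ∀ m : ℕ, (tuples m l).steps ≤ (m + 8) ^ 2 * N ^ m
  | 0 => by simp [tuples, op]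
  | m + 1 => by
    have ih := tuples_steps_le l hN hl m
    have hlen : (tuples m l).val.length ≤ N ^ m := by
      rw [length_tuples]; exact Nat.pow_le_pow_left hl m
    have hpow : 1 ≤ N ^ m := Nat.one_le_pow _ _ hN
    have hpow' : N ^ m ≤ N ^ (m + 1) := Nat.pow_le_pow_right hN (Nat.le_succ m)
    have hNN : N ≤ N ^ (m + 1) := Nat.le_self_pow (Nat.succ_ne_zero m) N
    have h1 : (tuples (m + 1) l).steps ≤ (tuples m l).steps +
        (1 + N * ((1 + N ^ m * (m + 1 + 2)) + N ^ m + 2)) := by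
      simp only [tuples, steps_bind, collectMany, collect]
      refine Nat.add_le_add_left (Nat.add_le_add_left (sum_map_le l _ (fun a _ => ?_) hl) 1) _
      rw [List.length_map]
      have := sum_map_le (tuples m l).val (fun _ => m + 1 + 2) (fun _ _ => le_rfl) hlen
      omega
    have h2 : N * ((1 + N ^ m * (m + 1 + 2)) + N ^ m + 2) = 3 * N + (m + 4) * N ^ (m + 1) := by
      ring
    calc (tuples (m + 1) l).steps
        ≤ (m + 8) ^ 2 * N ^ m + (1 + (3 * N + (m + 4) * N ^ (m + 1))) := by omega
      _ ≤ (m + 8) ^ 2 * N ^ (m + 1)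
          + (N ^ (m + 1) + (3 * N ^ (m + 1) + (m + 4) * N ^ (m + 1))) := by
        gcongr
        exact hpow.trans hpow'
      _ = ((m + 8) ^ 2 + (m + 8)) * N ^ (m + 1) := by ring
      _ ≤ (m + 1 + 8) ^ 2 * N ^ (m + 1) := by
        gcongr
        nlinarith

section Steps

variable {n d k m τ : ℕ}

lemma nearestLoop_steps (C : Centers k d) (x : Point d) :
    (nearestLoop C x).steps = 1 + k * (5 * d + 4) := by
  simp only [nearestLoop, distLoop, Timed.minLoop, Timed.sumLoop, Timed.steps_bind, Timed.op,
    Finset.sum_const, Finset.card_univ, Fintype.card_fin, smul_eq_mul]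
  ring

lemma costLoop_steps (C : Centers k d) (X : Fin n → Point d) :
    (costLoop C X).steps = 1 + n * (k * (5 * d + 4) + 3) := by
  simp only [costLoop, Timed.sumLoop, nearestLoop_steps, Finset.sum_const,
    Finset.card_univ, Fintype.card_fin, smul_eq_mul]
  ring

lemma sampleArray_steps {N : ℕ} (X : Fin n → Point d) (B : Centers k d) (τ : ℕ)
    (O : Fin N → Fin n) :
    (sampleArray X B τ O).steps = 1 + (N + k * (τ * k)) * (5 * d + 3) := by
  simp only [sampleArray, Timed.fill, Finset.sum_const,
    Finset.card_univ, Fintype.card_fin, smul_eq_mul]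
  ring

/-- A relation has at most `2 ^ k` tuples, and evaluating one scans all `k * τ` sample points; this
happens in each of the `d` coordinates. -/
lemma bestCenters_steps_le (J : ConstrainedInstance n d k) (M : Fin m → Point d)
    (S : Fin k → Fin τ → Fin m) (w : Fin k → ℝ) (hd : 1 ≤ d) (hk : 1 ≤ k) (hτ : 1 ≤ τ) :
    (bestCenters J M S w).steps ≤ 40 * (d * 2 ^ k * (k * τ)) := by
  have h1 : (bestCenters J M S w).steps
      ≤ 1 + d * (1 + 2 ^ k * (1 + k * (5 * τ + 5) + 3) + 3) + (1 + k * (3 * d + 3)) := by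
    simp only [bestCenters, Timed.steps_bind, Timed.fill, Timed.argminLoop, Timed.sumLoop, Timed.op]
    refine Nat.add_le_add (Nat.add_le_add_left ?_ 1) (le_of_eq ?_)
    swap
    · simp only [Finset.sum_const, Finset.card_univ, Fintype.card_fin, smul_eq_mul]
      ring
    refine (Finset.sum_le_card_nsmul _ _ _ fun i _ => ?_).trans_eq
      (by rw [Finset.card_univ, Fintype.card_fin, smul_eq_mul])
    have hcard : (J.rel i).toList.length ≤ 2 ^ k := by
      rw [Finset.length_toList]
      refine (Finset.card_le_univ _).trans_eq ?_
      simp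
    have := sum_map_le (J.rel i).toList (fun _ => 1 + k * (5 * τ + 5) + 3) (fun _ _ => le_rfl) hcard
    refine le_trans (le_of_eq ?_)
      (Nat.add_le_add_right (Nat.add_le_add_left this 1) 3)
    simp only [Finset.sum_const, Finset.card_univ, Fintype.card_fin, smul_eq_mul, List.map_const',
      List.sum_replicate]
    ring
  have hkt : 1 ≤ k * τ := Nat.mul_pos hk hτ
  have h2k : 1 ≤ 2 ^ k := Nat.one_le_two_pow
  have hkk : k ≤ k * τ := Nat.le_mul_of_pos_right _ hτ
  have ha : 1 + k * (5 * τ + 5) + 3 ≤ 14 * (k * τ) := by nlinarith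
  have hb : 1 ≤ 2 ^ k * (k * τ) := Nat.mul_pos h2k hkt
  have hc : 1 + 2 ^ k * (1 + k * (5 * τ + 5) + 3) + 3 ≤ 18 * (2 ^ k * (k * τ)) := by
    have := Nat.mul_le_mul_left (2 ^ k) ha
    nlinarith
  have he : k * τ ≤ 2 ^ k * (k * τ) := Nat.le_mul_of_pos_left _ h2k
  have hf : 2 ^ k * (k * τ) ≤ d * (2 ^ k * (k * τ)) := Nat.le_mul_of_pos_left _ hd
  have hg : d * (1 + 2 ^ k * (1 + k * (5 * τ + 5) + 3) + 3) ≤ 18 * (d * (2 ^ k * (k * τ))) := by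
    have := Nat.mul_le_mul_left d hc
    nlinarith
  have hh : k * (3 * d + 3) ≤ 6 * (d * (2 ^ k * (k * τ))) := by
    have h3 : k * d ≤ d * (2 ^ k * (k * τ)) := by
      rw [mul_comm]; exact Nat.mul_le_mul_left d (hkk.trans he)
    have h4 : k ≤ d * (2 ^ k * (k * τ)) := hkk.trans (he.trans hf)
    nlinarith
  have : d * 2 ^ k * (k * τ) = d * (2 ^ k * (k * τ)) := mul_assoc _ _ _
  rw [this]
  omega

lemma length_subsetsLoop_le (m τ : ℕ) : (subsetsLoop m τ).val.length ≤ m ^ τ := by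
  simp only [subsetsLoop, Timed.val_bind, Timed.select]
  refine (List.length_filter_le _ _).trans_eq ?_
  rw [Timed.length_tuples, List.length_finRange]

lemma length_disjointSubsetsLoop_le (m k τ : ℕ) :
    (disjointSubsetsLoop m k τ).val.length ≤ (m ^ τ) ^ k := by
  simp only [disjointSubsetsLoop, Timed.val_bind, Timed.select]
  refine (List.length_filter_le _ _).trans ?_
  rw [Timed.length_tuples]
  exact Nat.pow_le_pow_left (length_subsetsLoop_le m τ) k

lemma subsetsLoop_steps_le (hm : 1 ≤ m) (hτ : 1 ≤ τ) :
    (subsetsLoop m τ).steps ≤ 95 * τ ^ 2 * m ^ τ := by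
  have h1 : (subsetsLoop m τ).steps
      ≤ m + ((τ + 8) ^ 2 * m ^ τ + (1 + m ^ τ * (1 + τ * (6 * τ + 3) + 2))) := by
    simp only [subsetsLoop, Timed.steps_bind, Timed.select]
    refine Nat.add_le_add_left (Nat.add_le_add
      (Timed.tuples_steps_le _ hm (List.length_finRange).le τ)
      (Nat.add_le_add_left (sum_map_le _ _ (fun s _ => le_of_eq ?_) ?_) 1)) m
    · simp only [Timed.allLoop, Finset.sum_const, Finset.card_univ, Fintype.card_fin, smul_eq_mul]
      ring
    · rw [Timed.length_tuples, List.length_finRange]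
  have h2 : m ≤ m ^ τ := Nat.le_self_pow (by omega) m
  have h3 : 1 ≤ m ^ τ := hm.trans h2
  calc (subsetsLoop m τ).steps
      ≤ m ^ τ + ((τ + 8) ^ 2 * m ^ τ + (m ^ τ + m ^ τ * (1 + τ * (6 * τ + 3) + 2))) := by omega
    _ = (7 * τ ^ 2 + 19 * τ + 69) * m ^ τ := by ring
    _ ≤ _ := by
      gcongr
      nlinarith

lemma disjointSubsetsLoop_steps_le (hm : 1 ≤ m) (hk : 1 ≤ k) (hτ : 1 ≤ τ) :
    (disjointSubsetsLoop m k τ).steps ≤ 195 * (k ^ 2 * τ ^ 2) * (m ^ τ) ^ k := by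
  have hmτ : 1 ≤ m ^ τ := Nat.one_le_pow _ _ hm
  have h1 : (disjointSubsetsLoop m k τ).steps ≤ 95 * τ ^ 2 * m ^ τ
      + ((k + 8) ^ 2 * (m ^ τ) ^ k
        + (1 + (m ^ τ) ^ k * (1 + k * (1 + k * (1 + τ * (6 * τ + 3) + 2) + 2) + 2))) := by
    simp only [disjointSubsetsLoop, Timed.steps_bind, Timed.select]
    refine Nat.add_le_add (subsetsLoop_steps_le hm hτ) (Nat.add_le_add
      (Timed.tuples_steps_le _ hmτ (length_subsetsLoop_le m τ) k)
      (Nat.add_le_add_left (sum_map_le _ _ (fun s _ => le_of_eq ?_) ?_) 1))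
    · simp only [Timed.allLoop, Finset.sum_const, Finset.card_univ, Fintype.card_fin, smul_eq_mul]
      ring
    · rw [Timed.length_tuples]
      exact Nat.pow_le_pow_left (length_subsetsLoop_le m τ) k
  have h2 : m ^ τ ≤ (m ^ τ) ^ k := Nat.le_self_pow (by omega) _
  have h3 : 1 ≤ (m ^ τ) ^ k := hmτ.trans h2
  have hk2 : k ≤ k ^ 2 := Nat.le_self_pow (by omega) k
  have hτ2 : τ ≤ τ ^ 2 := Nat.le_self_pow (by omega) τ
  have e1 : k ^ 2 ≤ k ^ 2 * τ ^ 2 := Nat.le_mul_of_pos_right _ (by positivity)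
  have e2 : τ ^ 2 ≤ k ^ 2 * τ ^ 2 := Nat.le_mul_of_pos_left _ (by positivity)
  have e3 : k ^ 2 * τ ≤ k ^ 2 * τ ^ 2 := Nat.mul_le_mul_left _ hτ2
  calc (disjointSubsetsLoop m k τ).steps
      ≤ 95 * τ ^ 2 * (m ^ τ) ^ k + ((k + 8) ^ 2 * (m ^ τ) ^ k + ((m ^ τ) ^ k
        + (m ^ τ) ^ k * (1 + k * (1 + k * (1 + τ * (6 * τ + 3) + 2) + 2) + 2))) := by
        have := Nat.mul_le_mul_left (95 * τ ^ 2) h2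
        omega
    _ = (95 * τ ^ 2 + 6 * (k ^ 2 * τ ^ 2) + 3 * (k ^ 2 * τ) + 4 * k ^ 2 + 19 * k + 68)
        * (m ^ τ) ^ k := by ring
    _ ≤ _ := by
      gcongr
      omega

lemma length_roundCandidates_le (J : ConstrainedInstance n d k) (B : Centers k d) (W : List ℝ)
    (τ η : ℕ) (O : Fin (η * k) → Fin n) : (roundCandidates J B W τ η O).val.length
      ≤ ((η * k + k * (τ * k)) ^ τ) ^ k * W.length ^ k := by
  simp only [roundCandidates, Timed.val_bind, Timed.collectMany, Timed.collect,
    List.length_flatMap, List.length_map, Timed.length_tuples]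
  exact sum_map_le _ _ (fun _ _ => le_rfl) (length_disjointSubsetsLoop_le _ _ _)

/-- `Q` collects the polynomial overheads and `Z` the factors coming from the enumeration. All
quantities are at least 1, so every summand is dominated by `Q * Z`. -/
lemma roundCandidates_steps_le (J : ConstrainedInstance n d k) (B : Centers k d) (W : List ℝ)
    (τ η : ℕ) (O : Fin (η * k) → Fin n) (hd : 1 ≤ d) (hk : 1 ≤ k) (hτ : 1 ≤ τ)
    (hW : 1 ≤ W.length) : (roundCandidates J B W τ η O).steps
      ≤ 340 * ((η * k + k * (τ * k)) * (k ^ 2 * τ ^ 2)) *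
        (d * 2 ^ k * W.length ^ k * ((η * k + k * (τ * k)) ^ τ) ^ k) := by
  set m := η * k + k * (τ * k) with hm
  have hm1 : 1 ≤ m := by
    have : 1 ≤ k * (τ * k) := Nat.mul_pos hk (Nat.mul_pos hτ hk)
    omega
  set L := W.length ^ k with hL
  set F := (m ^ τ) ^ k with hF
  have hL1 : 1 ≤ L := Nat.one_le_pow _ _ hW
  have hF1 : 1 ≤ F := Nat.one_le_pow _ _ (Nat.one_le_pow _ _ hm1)
  have hP : 1 ≤ 2 ^ k := Nat.one_le_two_pow
  have h1 : (roundCandidates J B W τ η O).steps ≤ (1 + m * (5 * d + 3))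
      + (195 * (k ^ 2 * τ ^ 2) * F + ((k + 8) ^ 2 * L +
        (1 + F * ((1 + L * (40 * (d * 2 ^ k * (k * τ)) + 2)) + L + 2)))) := by
    simp only [roundCandidates, Timed.steps_bind]
    refine Nat.add_le_add (sampleArray_steps _ _ _ _).le (Nat.add_le_add
      (disjointSubsetsLoop_steps_le hm1 hk hτ) (Nat.add_le_add
        (Timed.tuples_steps_le W hW le_rfl k) ?_))
    simp only [Timed.collectMany]
    refine Nat.add_le_add_left (sum_map_le _ _ (fun S _ => ?_)
      (length_disjointSubsetsLoop_le _ _ _)) 1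
    simp only [Timed.collect, List.length_map, Timed.length_tuples]
    refine Nat.add_le_add_right (Nat.add_le_add_right (Nat.add_le_add_left
      (sum_map_le _ _ (fun w _ => ?_) (Timed.length_tuples W k).le) 1) _) 2
    exact Nat.add_le_add_right (bestCenters_steps_le J _ S w hd hk hτ) 2
  set Z := d * 2 ^ k * L * F with hZ
  set Q := m * (k ^ 2 * τ ^ 2) with hQ
  have hdP : 1 ≤ d * 2 ^ k := Nat.mul_pos hd hP
  have hLF : 1 ≤ L * F := Nat.mul_pos hL1 hF1
  have zZ : d * 2 ^ k * (L * F) = Z := by rw [hZ]; ring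
  have zLF : L * F ≤ Z := by rw [← zZ]; exact Nat.le_mul_of_pos_left _ hdP
  have zF : F ≤ Z := (Nat.le_mul_of_pos_left _ hL1).trans zLF
  have zL : L ≤ Z := (Nat.le_mul_of_pos_right _ hF1).trans zLF
  have z1 : 1 ≤ Z := hF1.trans zF
  have zd : d ≤ Z := by
    rw [← zZ]
    exact (Nat.le_mul_of_pos_right _ hP).trans (Nat.le_mul_of_pos_right _ hLF)
  have hkτ : 1 ≤ k ^ 2 * τ ^ 2 := Nat.mul_pos (Nat.pow_pos hk) (Nat.pow_pos hτ)
  have qm : m ≤ Q := Nat.le_mul_of_pos_right _ hkτ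
  have qkτ : k ^ 2 * τ ^ 2 ≤ Q := Nat.le_mul_of_pos_left _ hm1
  have q1 : 1 ≤ Q := hm1.trans qm
  have qk2 : k ^ 2 ≤ Q := (Nat.le_mul_of_pos_right _ (Nat.pow_pos hτ)).trans qkτ
  have qkt : k * τ ≤ Q := by
    refine le_trans ?_ qkτ
    rw [← mul_pow]
    exact Nat.le_self_pow (by omega) _
  have t1 : m * d ≤ Q * Z := Nat.mul_le_mul qm zd
  have t2 : m ≤ Q * Z := qm.trans (Nat.le_mul_of_pos_right _ z1)
  have t3 : (k ^ 2 * τ ^ 2) * F ≤ Q * Z := Nat.mul_le_mul qkτ zF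
  have t4 : k ^ 2 * L ≤ Q * Z := Nat.mul_le_mul qk2 zL
  have t5 : (k * τ) * Z ≤ Q * Z := Nat.mul_le_mul_right _ qkt
  have t6 : Z ≤ Q * Z := Nat.le_mul_of_pos_left _ q1
  have t7 : (k + 8) ^ 2 * L ≤ 81 * (k ^ 2 * L) := by
    rw [← mul_assoc]
    refine Nat.mul_le_mul_right _ ?_
    nlinarith
  have e1 : F * ((1 + L * (40 * (d * 2 ^ k * (k * τ)) + 2)) + L + 2)
      = 40 * ((k * τ) * Z) + 3 * (L * F) + 3 * F := by
    rw [hZ]; ring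
  have e2 : m * (5 * d + 3) = 5 * (m * d) + 3 * m := by ring
  have e3 : 195 * (k ^ 2 * τ ^ 2) * F = 195 * ((k ^ 2 * τ ^ 2) * F) := by ring
  have e4 : 340 * Q * Z = 340 * (Q * Z) := by ring
  rw [e1, e2, e3] at h1
  rw [e4]
  omega

lemma length_guesses_le (ε : ℝ) (n : ℕ) (zero : Bool) :
    1 ≤ (guesses ε n zero).val.length ∧
      (guesses ε n zero).val.length ≤ ⌈Real.logb (1 + ε / 2) n⌉₊ + 2 := by
  cases zero <;> simp [guesses, Timed.val_bind, Timed.op, Timed.collect]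

lemma guesses_steps_le (ε : ℝ) (n : ℕ) (zero : Bool) :
    (guesses ε n zero).steps ≤ 4 * (guesses ε n zero).val.length + 2 := by
  cases zero <;>
  simp [guesses, Timed.val_bind, Timed.steps_bind, Timed.op, Timed.collect] <;> omega

end Steps

lemma weightedDraw_all {n : ℕ} [NeZero n] (D : Fin n → ℕ) :
    (weightedDraw D).All fun _ s => True ∧ s ≤ 3 * n + 1 := by
  intro r hr
  rw [Rand.outcomes, weightedDraw, PMF.mem_support_map_iff] at hr
  obtain ⟨i, -, rfl⟩ := hr
  exact ⟨trivial, le_rfl⟩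

/-! ### Feasibility and step count of the whole algorithm -/

section Outcomes

variable {n d k : ℕ}

lemma Rand.All.trivial {α : Type} (p : Rand α) : p.All fun _ _ => True := fun _ _ => True.intro

lemma Rand.All.replicate_val {α : Type} {p : Rand α} {P : α → Prop} (hp : p.All fun a _ => P a) :
    ∀ m, (Rand.replicate m p).All fun t _ => ∀ i, P (t i)
  | 0 => Rand.all_lift fun i => i.elim0
  | m + 1 => by
    refine hp.bind fun a _ ha => (Rand.All.replicate_val hp m).bind fun t _ ht =>
      Rand.all_lift fun i => ?_
    refine Fin.cases ?_ (fun i => ?_) i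
    · simpa using ha
    · simpa using ht i

/-- The `τ * k` copies of one center of `B` already form `k` disjoint samples, whatever was drawn.
-/
lemma roundCandidates_ne_nil [NeZero k] {J : ConstrainedInstance n d k}
    (hJ : ∀ i, (J.rel i).Nonempty) (B : Centers k d) {W : List ℝ} (hW : 1 ≤ W.length) (τ η : ℕ)
    (O : Fin (η * k) → Fin n) : ∃ C, C ∈ (roundCandidates J B W τ η O).val := by
  obtain ⟨x, hx⟩ := List.exists_mem_of_length_pos hW
  obtain ⟨C, hC, -⟩ := exists_mem_roundCandidates hJ (B := B) (W := W) (O := O)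
    (P := fun j (t : Fin τ) => Fin.natAdd _ (finProdFinEquiv (0, finProdFinEquiv (t, j))))
    (fun j l x y h => by
      have := finProdFinEquiv.injective (Fin.natAdd_injective _ _ h)
      simp only [Prod.mk.injEq, true_and] at this
      have := finProdFinEquiv.injective this
      simp only [Prod.mk.injEq] at this
      exact this.symm) (w := fun _ => x) (fun _ => hx)
  exact ⟨C, hC⟩

/-- The algorithm always returns centers that satisfy the relations. -/
lemma goodCenters_satisfies [NeZero n] [NeZero k] {J : ConstrainedInstance n d k}
    (hJ : ∀ i, (J.rel i).Nonempty) (B : Centers k d) (ε : ℝ) (zero : Bool) (τ η : ℕ) {ζ : ℕ}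
    (hζ : 1 ≤ ζ) :
    (goodCenters J B ε zero τ η ζ).All fun out _ => ∃ D, out = some D ∧ J.Satisfies D := by
  rw [goodCenters_eq]
  refine (Rand.All.trivial _).bind fun D _ _ => ?_
  refine (Rand.all_lift (Q := fun W _ => 1 ≤ W.length) (length_guesses_le ε n zero).1).bind
    fun W _ hW => ?_
  have hround : (samplingRound J B D W τ η).All fun L _ =>
      (∀ C ∈ L, J.Satisfies C) ∧ ∃ C, C ∈ L := by
    rw [samplingRound_eq]
    exact (Rand.All.trivial _).bind fun O _ _ => Rand.all_lift
      ⟨fun C => satisfies_of_mem_roundCandidates hJ, roundCandidates_ne_nil hJ B hW τ η O⟩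
  refine (hround.replicate_val ζ).bind fun rounds _ hr => Rand.all_lift ?_
  obtain ⟨C, hC⟩ := (hr ⟨0, hζ⟩).2
  obtain ⟨E, hE, ⟨r, hr'⟩, -⟩ := exists_selectBest J hC
  exact ⟨E, hE, (hr r).1 E hr'⟩

/-- The main costs are the enumeration in `ζ` rounds and the evaluation of every candidate on all
`n` points; each summand is dominated by one common product `T`, and the constant 400 covers their
coefficients. -/
lemma goodCenters_steps_le [NeZero n] (J : ConstrainedInstance n d k) (B : Centers k d) (ε : ℝ)
    (zero : Bool) {τ η ζ : ℕ} (hd : 1 ≤ d) (hk : 1 ≤ k) (hτ : 1 ≤ τ) (hη : 1 ≤ η) (hζ : 1 ≤ ζ) :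
    (goodCenters J B ε zero τ η ζ).All fun _ s =>
      s ≤ 400 * (ζ * η * (η * k + k * (τ * k)) * (k ^ 2 * τ ^ 2)) *
        (n * (d * 2 ^ k * (guesses ε n zero).val.length ^ k *
          ((η * k + k * (τ * k)) ^ τ) ^ k)) := by
  set m := η * k + k * (τ * k) with hm
  have hm1 : 1 ≤ m := by
    have : 1 ≤ k * (τ * k) := Nat.mul_pos hk (Nat.mul_pos hτ hk)
    omega
  have hn : 1 ≤ n := NeZero.one_le
  set F := (m ^ τ) ^ k with hF
  set W := (guesses ε n zero).val with hWdef
  have hW : 1 ≤ W.length := (length_guesses_le ε n zero).1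
  set Z := d * 2 ^ k * W.length ^ k * F with hZ
  set Q := m * (k ^ 2 * τ ^ 2) with hQ
  have hround : ∀ D, (samplingRound J B D W τ η).All fun L s =>
      L.length ≤ F * W.length ^ k ∧ s ≤ 1 + η * k * (3 * n + 3) + 340 * Q * Z := by
    intro D
    rw [samplingRound_eq]
    refine ((weightedDraw_all D).replicate (η * k)).bind fun O s hs => Rand.all_lift
      ⟨length_roundCandidates_le J B W τ η O, ?_⟩
    exact Nat.add_le_add hs.2 (roundCandidates_steps_le J B W τ η O hd hk hτ hW)
  have hall : (goodCenters J B ε zero τ η ζ).All fun _ s =>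
      s ≤ (1 + n * (k * (5 * d + 4) + 3)) + ((4 * W.length + 2) +
        ((1 + ζ * (1 + η * k * (3 * n + 3) + 340 * Q * Z + 2)) +
          (ζ + ((1 + ζ * (1 + F * W.length ^ k + 2)) +
            (1 + ζ * (F * W.length ^ k) * (1 + n * (k * (5 * d + 4) + 3) + 3)))))) := by
    rw [goodCenters_eq]
    refine (Rand.all_lift (Q := fun _ s => s ≤ 1 + n * (k * (5 * d + 4) + 3)) ?_).bind
      fun D s hs => ?_
    · simp only [Timed.fill, nearestLoop_steps, Finset.sum_const, Finset.card_univ,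
        Fintype.card_fin, smul_eq_mul]
      exact le_of_eq (by ring)
    refine (Rand.all_lift (Q := fun W' s => W' = W ∧ s ≤ 4 * W.length + 2)
      ⟨rfl, guesses_steps_le ε n zero⟩).bind fun W' s' hs' => ?_
    obtain ⟨rfl, hs'⟩ := hs'
    refine ((hround D).replicate ζ).bind fun rounds s'' hs'' => Rand.all_lift ?_
    refine Nat.add_le_add hs (Nat.add_le_add hs' (Nat.add_le_add hs''.2 ?_))
    simp only [selectBest, Timed.steps_bind, Timed.collectMany, Timed.op,
      Timed.argminLoop, costLoop_steps]
    refine Nat.add_le_add_left (Nat.add_le_add (Nat.add_le_add_left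
      (sum_map_le _ _ (fun r _ => ?_) (List.length_finRange).le) 1)
      (Nat.add_le_add_left (sum_map_le _ _ (fun C _ => le_rfl) ?_) 1)) ζ
    · exact Nat.add_le_add_right (Nat.add_le_add_left (hs''.1 r) 1) 2
    · rw [List.length_flatMap]
      exact sum_map_le _ _ (fun r _ => hs''.1 r) (List.length_finRange).le
  refine hall.mono fun _ s hs => hs.trans ?_
  set V := F * W.length ^ k with hV
  have hV1 : 1 ≤ V := Nat.mul_pos (Nat.one_le_pow _ _ (Nat.one_le_pow _ _ hm1))
    (Nat.one_le_pow _ _ hW)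
  have hP : 1 ≤ 2 ^ k := Nat.one_le_two_pow
  have hWV : W.length ≤ V := (Nat.le_self_pow (by omega) _).trans
    (Nat.le_mul_of_pos_left _ (Nat.one_le_pow _ _ (Nat.one_le_pow _ _ hm1)))
  have zZ : d * V * 2 ^ k = Z := by rw [hZ, hV]; ring
  have zdV : d * V ≤ Z := by rw [← zZ]; exact Nat.le_mul_of_pos_right _ hP
  have zV : V ≤ Z := (Nat.le_mul_of_pos_left _ hd).trans zdV
  have zd : d ≤ Z := (Nat.le_mul_of_pos_right _ hV1).trans zdV
  have z1 : 1 ≤ Z := hV1.trans zV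
  have hkτ : 1 ≤ k ^ 2 * τ ^ 2 := Nat.mul_pos (Nat.pow_pos hk) (Nat.pow_pos hτ)
  have qm : m ≤ Q := Nat.le_mul_of_pos_right _ hkτ
  have qk : k ≤ Q := by
    refine le_trans ?_ (Nat.le_mul_of_pos_left _ hm1)
    exact (Nat.le_self_pow (by omega) k).trans (Nat.le_mul_of_pos_right _ (Nat.pow_pos hτ))
  have q1 : 1 ≤ Q := hm1.trans qm
  have nZ : Z ≤ n * Z := Nat.le_mul_of_pos_left _ hn
  set R := ζ * η * Q with hR
  have rQ : Q ≤ R := Nat.le_mul_of_pos_left _ (Nat.mul_pos hζ hη)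
  have rζQ : ζ * Q ≤ R := by
    rw [hR, mul_assoc]
    exact Nat.mul_le_mul_left _ (Nat.le_mul_of_pos_left _ hη)
  have rζ : ζ ≤ R := (Nat.le_mul_of_pos_right _ q1).trans rζQ
  have r1 : 1 ≤ R := q1.trans rQ
  set T := R * (n * Z) with hT
  have hnZ1 : 1 ≤ n * Z := z1.trans nZ
  have t0 : n * Z ≤ T := Nat.le_mul_of_pos_left _ r1
  have t1 : n * (k * d) ≤ T := by
    calc n * (k * d) = k * (n * d) := by ring
      _ ≤ R * (n * Z) := Nat.mul_le_mul (qk.trans rQ) (Nat.mul_le_mul_left n zd)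
  have t2 : n * k ≤ T := (Nat.mul_le_mul_left n (Nat.le_mul_of_pos_right k hd)).trans t1
  have t3 : n ≤ T := (Nat.le_mul_of_pos_right n z1).trans t0
  have t4 : W.length ≤ T := hWV.trans (zV.trans (nZ.trans t0))
  have t5 : ζ * (η * k * n) ≤ T := by
    calc ζ * (η * k * n) = ζ * η * k * (n * 1) := by ring
      _ ≤ ζ * η * Q * (n * Z) := by gcongr
  have t6 : ζ * (η * k) ≤ T := (Nat.mul_le_mul_left ζ (Nat.le_mul_of_pos_right _ hn)).trans t5
  have t7 : ζ * (Q * Z) ≤ T := by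
    rw [← mul_assoc]
    exact Nat.mul_le_mul rζQ nZ
  have t8 : ζ ≤ T := rζ.trans (Nat.le_mul_of_pos_right _ hnZ1)
  have t9 : ζ * V ≤ T := Nat.mul_le_mul rζ (zV.trans nZ)
  have t10 : ζ * V * (n * (k * d)) ≤ T := by
    calc ζ * V * (n * (k * d)) = ζ * k * (n * (d * V)) := by ring
      _ ≤ R * (n * Z) := Nat.mul_le_mul ((Nat.mul_le_mul_left ζ qk).trans rζQ)
        (Nat.mul_le_mul_left n zdV)
  have t11 : ζ * V * (n * k) ≤ T :=
    (Nat.mul_le_mul_left _ (Nat.mul_le_mul_left n (Nat.le_mul_of_pos_right k hd))).trans t10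
  have t12 : ζ * V * n ≤ T :=
    (Nat.mul_le_mul_left _ (Nat.le_mul_of_pos_right n hk)).trans t11
  have e0 : 400 * (ζ * η * m * (k ^ 2 * τ ^ 2)) * (n * Z) = 400 * T := by
    rw [hT, hR, hQ]; ring
  rw [e0]
  calc _ = 2 + 5 * (n * (k * d)) + 4 * (n * k) + 3 * n + 4 * W.length + 3
        + 3 * (ζ * (η * k * n)) + 3 * (ζ * (η * k)) + 340 * (ζ * (Q * Z)) + 7 * ζ
        + ζ * V + 5 * (ζ * V * (n * (k * d))) + 4 * (ζ * V * (n * k)) + 3 * (ζ * V * n)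
        + 4 * (ζ * V) + 1 := by ring
    _ ≤ 400 * T := by omega

end Outcomes

/-! ### The running time in terms of the parameters of the problem -/

/-- From `log (1 + ε / 2) ≥ ε / 4` the exponents number about `4 / ε * log n`; since `n ≥ 2`, the
additive 3 from rounding, the exponent 0 and the guess 0 is absorbed as well. -/
lemma length_guesses_le_log {ε : ℝ} (hε : 0 < ε) (hε' : ε ≤ 1 / 2) {n : ℕ} (hn : 2 ≤ n)
    (zero : Bool) : ((guesses ε n zero).val.length : ℝ) ≤ 9 / ε * Real.log n := by
  have hn' : (2 : ℝ) ≤ n := by exact_mod_cast hn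
  have hlogn : 0.69 ≤ Real.log n :=
    (by linarith [Real.log_two_gt_d9] : (0.69 : ℝ) ≤ Real.log 2).trans
      (Real.log_le_log (by norm_num) hn')
  have hlog : ε / 4 ≤ Real.log (1 + ε / 2) := by
    have h1 := Real.one_sub_inv_le_log_of_pos (by linarith : (0 : ℝ) < 1 + ε / 2)
    refine le_trans ?_ h1
    rw [le_sub_iff_add_le, ← le_sub_iff_add_le', inv_le_iff_one_le_mul₀ (by linarith)]
    nlinarith
  have hlogb : Real.logb (1 + ε / 2) n ≤ 4 / ε * Real.log n := by
    rw [Real.logb, div_le_iff₀ (by linarith)]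
    calc Real.log n = 4 / ε * Real.log n * (ε / 4) := by field_simp
      _ ≤ _ := mul_le_mul_of_nonneg_left hlog (by positivity)
  have h0 : 0 ≤ Real.logb (1 + ε / 2) n := Real.logb_nonneg (by linarith) (by linarith)
  have h1 : ((guesses ε n zero).val.length : ℝ) ≤ ⌈Real.logb (1 + ε / 2) n⌉₊ + 2 := by
    exact_mod_cast (length_guesses_le ε n zero).2
  have h2 := Nat.ceil_lt_add_one h0
  have h3 : 3 ≤ 5 / ε * Real.log n := by
    rw [div_mul_eq_mul_div, le_div_iff₀ hε]
    linarith
  have h4 : 9 / ε * Real.log n = 4 / ε * Real.log n + 5 / ε * Real.log n := by ring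
  linarith

/-- The constant in the exponent of the running time. -/
def timeConst (c α : ℝ) : ℝ :=
  Real.log (800 * c ^ 7 * α ^ 2) + 20 + c * (Real.log (2 * c ^ 2 * α) + 3)

-- With `x = k / ε ≥ 2`, all parameters are polynomial in `x`, hence `exp` of a multiple of `ℓ = 2 *
-- log x` up to constants. The dominant exponent is `τ * k * log m`, of order `x ^ 2 * ℓ ^ 2`: one
-- logarithm comes from `τ`, the other from `m`, so the power `a = 2` suffices.
set_option maxHeartbeats 400000 in
lemma steps_bound {c α ε : ℝ} (hc : 1 ≤ c) (hα : 1 ≤ α) (hε : 0 < ε) (hε' : ε ≤ 1 / 2)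
    {n d k τ η ζ L : ℕ} (hn : 1 ≤ n) (hk : 1 ≤ k)
    (hτ : (τ : ℝ) ≤ c * (k / ε ^ 2 * Real.log (k / ε)))
    (hη : (η : ℝ) ≤ c * (τ * α * k / ε ^ 2)) (hζ : (ζ : ℝ) ≤ c * (1 / ε))
    (hL : (L : ℝ) ≤ 9 / ε * Real.log n) :
    ((400 * (ζ * η * (η * k + k * (τ * k)) * (k ^ 2 * τ ^ 2)) *
        (n * (d * 2 ^ k * L ^ k * ((η * k + k * (τ * k)) ^ τ) ^ k)) : ℕ) : ℝ)
      ≤ n * d * Real.log n ^ k *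
        Real.exp (timeConst c α * (k ^ 2 / ε ^ 2 * Real.log (k ^ 2 / ε ^ 2) ^ 2)) := by
  have hk' : (1 : ℝ) ≤ k := by exact_mod_cast hk
  have hn' : (1 : ℝ) ≤ n := by exact_mod_cast hn
  have hlogn : 0 ≤ Real.log n := Real.log_nonneg hn'
  set x : ℝ := k / ε with hx
  have hx2 : 2 ≤ x := by
    rw [hx, le_div_iff₀ hε]; linarith
  have hkx : (k : ℝ) ≤ x := by
    rw [hx, le_div_iff₀ hε]; nlinarith
  have hεx : 1 / ε ≤ x := by
    rw [hx]; gcongr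
  have hyx : (k : ℝ) ^ 2 / ε ^ 2 = x ^ 2 := by rw [hx, div_pow]
  have hkεx : (k : ℝ) / ε ^ 2 ≤ x ^ 2 := by
    rw [← hyx]
    gcongr
    nlinarith
  have hl2 : 1 / 2 ≤ Real.log x := by
    have := Real.log_le_log (by norm_num) hx2
    linarith [Real.log_two_gt_d9]
  have hlx : Real.log x ≤ x := (Real.log_le_sub_one_of_pos (by linarith)).trans (by linarith)
  have hτk : (τ : ℝ) * k ≤ c * (x ^ 2 * Real.log x) := by
    calc (τ : ℝ) * k ≤ c * (k / ε ^ 2 * Real.log x) * k := by gcongr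
      _ = c * (k ^ 2 / ε ^ 2 * Real.log x) := by ring
      _ = _ := by rw [hyx]
  have hτ3 : (τ : ℝ) ≤ c * x ^ 3 := by
    calc (τ : ℝ) ≤ c * (k / ε ^ 2 * Real.log x) := hτ
      _ ≤ c * (x ^ 2 * x) := by gcongr
      _ = c * x ^ 3 := by ring
  have hη5 : (η : ℝ) ≤ c ^ 2 * α * x ^ 5 := by
    calc (η : ℝ) ≤ c * (τ * α * k / ε ^ 2) := hη
      _ = c * (τ * α * (k / ε ^ 2)) := by ring
      _ ≤ c * (c * x ^ 3 * α * x ^ 2) := by gcongr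
      _ = c ^ 2 * α * x ^ 5 := by ring
  have hζ1 : (ζ : ℝ) ≤ c * x := hζ.trans (by gcongr)
  set m : ℕ := η * k + k * (τ * k) with hm
  have hm6 : (m : ℝ) ≤ 2 * c ^ 2 * α * x ^ 6 := by
    have h1 : (η : ℝ) * k ≤ c ^ 2 * α * x ^ 5 * x := by gcongr
    have h2 : (k : ℝ) * (τ * k) ≤ x * (c * x ^ 3 * x) := by gcongr
    have h3 : x * (c * x ^ 3 * x) ≤ c ^ 2 * α * x ^ 6 := by
      have h4 : c ≤ c ^ 2 * α := (le_self_pow₀ hc (by norm_num)).trans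
        (le_mul_of_one_le_right (by positivity) hα)
      calc x * (c * x ^ 3 * x) = c * x ^ 5 := by ring
        _ ≤ c ^ 2 * α * x ^ 6 := by
          gcongr
          · linarith
          · norm_num
    rw [hm]
    push_cast
    calc (η : ℝ) * k + k * (τ * k) ≤ c ^ 2 * α * x ^ 5 * x + c ^ 2 * α * x ^ 6 := by linarith
      _ = _ := by ring
  set ℓ := Real.log (k ^ 2 / ε ^ 2) with hℓdef
  have hℓ : ℓ = 2 * Real.log x := by
    rw [hℓdef, hyx, Real.log_pow]; norm_num
  have hℓ1 : 1 ≤ ℓ := by linarith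
  set T := (k : ℝ) ^ 2 / ε ^ 2 * ℓ ^ 2 with hTdef
  have hTx : T = x ^ 2 * ℓ ^ 2 := by rw [hTdef, hyx]
  have hℓT : ℓ ≤ T := by
    rw [hTx]
    exact (le_self_pow₀ hℓ1 (by norm_num)).trans
      (le_mul_of_one_le_left (by positivity) (one_le_pow₀ (by linarith)))
  have hxT : x ≤ T := by
    rw [hTx]
    exact (le_self_pow₀ (by linarith) (by norm_num)).trans
      (le_mul_of_one_le_right (by positivity) (one_le_pow₀ hℓ1))
  clear_value m x ℓ T
  have hT1 : 1 ≤ T := hℓ1.trans hℓT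
  have hlog1 : 0 ≤ Real.log (800 * c ^ 7 * α ^ 2) := by
    refine Real.log_nonneg ?_
    have : 1 ≤ c ^ 7 * α ^ 2 := one_le_mul_of_one_le_of_one_le (one_le_pow₀ hc) (one_le_pow₀ hα)
    linarith
  have hlog2 : 0 ≤ Real.log (2 * c ^ 2 * α) := by
    refine Real.log_nonneg ?_
    have : 1 ≤ c ^ 2 * α := one_le_mul_of_one_le_of_one_le (one_le_pow₀ hc) hα
    linarith
  have hpoly : (400 * (ζ * η * m * (k ^ 2 * τ ^ 2)) : ℝ)
      ≤ Real.exp ((Real.log (800 * c ^ 7 * α ^ 2) + 10) * T) := by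
    calc (400 * (ζ * η * m * (k ^ 2 * τ ^ 2)) : ℝ)
        ≤ 400 * ((c * x) * (c ^ 2 * α * x ^ 5) * (2 * c ^ 2 * α * x ^ 6) *
            (x ^ 2 * (c * x ^ 3) ^ 2)) := by gcongr
      _ = 800 * c ^ 7 * α ^ 2 * x ^ 20 := by ring
      _ = Real.exp (Real.log (800 * c ^ 7 * α ^ 2) + 10 * ℓ) := by
          rw [Real.exp_add, Real.exp_log (by positivity), hℓ,
            show 10 * (2 * Real.log x) = (20 : ℕ) * Real.log x by push_cast; ring,
            Real.exp_nat_mul, Real.exp_log (by linarith)]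
      _ ≤ _ := by
          refine Real.exp_le_exp.2 ?_
          linarith [mul_le_mul_of_nonneg_left hT1 hlog1]
  have h2k : (2 : ℝ) ^ k ≤ Real.exp T := by
    calc (2 : ℝ) ^ k ≤ Real.exp 1 ^ k :=
          pow_le_pow_left₀ (by norm_num) (by linarith [Real.add_one_le_exp (1 : ℝ)]) k
      _ = Real.exp k := by rw [← Real.exp_nat_mul, mul_one]
      _ ≤ Real.exp T := Real.exp_le_exp.2 (hkx.trans hxT)
  -- The crude bound `9 / ε ≤ exp (9 / ε)` is enough, because its `k`-th power is only `exp (9 *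
  -- x)`.
  have hLk : (L : ℝ) ^ k ≤ Real.log n ^ k * Real.exp (9 * T) := by
    calc (L : ℝ) ^ k ≤ (9 / ε * Real.log n) ^ k := by gcongr
      _ = Real.log n ^ k * (9 / ε) ^ k := by rw [mul_pow, mul_comm]
      _ ≤ Real.log n ^ k * Real.exp (9 / ε) ^ k := by
          gcongr
          linarith [Real.add_one_le_exp (9 / ε)]
      _ = Real.log n ^ k * Real.exp (9 * x) := by
          rw [← Real.exp_nat_mul, hx]
          congr 2
          ring
      _ ≤ _ := by gcongr
  have hmτ : ((m : ℝ) ^ τ) ^ k ≤ Real.exp (c * (Real.log (2 * c ^ 2 * α) + 3) * T) := by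
    calc ((m : ℝ) ^ τ) ^ k ≤ ((2 * c ^ 2 * α * x ^ 6) ^ τ) ^ k := by gcongr
      _ = Real.exp ((τ * k) * (Real.log (2 * c ^ 2 * α) + 3 * ℓ)) := by
          rw [← pow_mul, ← Nat.cast_mul, Real.exp_nat_mul, Real.exp_add,
            Real.exp_log (by positivity), hℓ,
            show 3 * (2 * Real.log x) = (6 : ℕ) * Real.log x by push_cast; ring,
            Real.exp_nat_mul, Real.exp_log (by linarith)]
      _ ≤ _ := by
          refine Real.exp_le_exp.2 ?_
          calc (τ * k) * (Real.log (2 * c ^ 2 * α) + 3 * ℓ)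
              ≤ (c * (x ^ 2 * Real.log x)) * ((Real.log (2 * c ^ 2 * α) + 3) * ℓ) := by
                refine mul_le_mul hτk ?_ (by positivity) (by positivity)
                linarith [mul_le_mul_of_nonneg_left hℓ1 hlog2]
            _ ≤ (c * (x ^ 2 * ℓ)) * ((Real.log (2 * c ^ 2 * α) + 3) * ℓ) := by
                gcongr
                linarith
            _ = _ := by rw [hTx]; ring
  -- The 20 in `timeConst` is `10 + 1 + 9`, from the polynomial factor, `2 ^ k` and the guesses.
  have hexp : Real.exp (timeConst c α * T)
      = Real.exp ((Real.log (800 * c ^ 7 * α ^ 2) + 10) * T) * Real.exp T *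
        Real.exp (9 * T) * Real.exp (c * (Real.log (2 * c ^ 2 * α) + 3) * T) := by
    rw [← Real.exp_add, ← Real.exp_add, ← Real.exp_add, timeConst]
    congr 1
    ring
  rw [hexp]
  push_cast
  calc (400 * (ζ * η * m * (k ^ 2 * τ ^ 2)) * (n * (d * 2 ^ k * L ^ k * (m ^ τ) ^ k)) : ℝ)
      ≤ Real.exp ((Real.log (800 * c ^ 7 * α ^ 2) + 10) * T) *
        (n * (d * Real.exp T * (Real.log n ^ k * Real.exp (9 * T)) *
          Real.exp (c * (Real.log (2 * c ^ 2 * α) + 3) * T))) := by gcongr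
    _ = _ := by ring

end BinaryKMeans

end

/-! ### Choice of the constants -/

theorem theorem3 :
    ∃ c₀ : ℝ, 0 < c₀ ∧ ∀ c₁ α : ℝ, 1 ≤ α → ∃ (A : ℝ) (a : ℕ),
      ∀ (n d k : ℕ) [NeZero n] [NeZero k] (J : BinaryKMeans.ConstrainedInstance n d k)
        (B : BinaryKMeans.Centers k d) (ε : ℝ) (zero : Bool) (τ η ζ : ℕ),
        0 < ε → ε ≤ 1 / 2 →
        (∀ i, (J.rel i).Nonempty) →
        BinaryKMeans.IsApproxSolution α J.points B →
        BinaryKMeans.Between c₀ c₁ (k / ε ^ 2 * Real.log (k / ε)) τ →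
        BinaryKMeans.Between c₀ c₁ (τ * α * k / ε ^ 2) η →
        BinaryKMeans.Between c₀ c₁ (1 / ε) ζ →
        (∀ r ∈ (BinaryKMeans.goodCenters J B ε zero τ η ζ).outcomes,
          ∃ D, r.val = some D ∧ J.Satisfies D) ∧
        (zero = true ∨ J.HasFullOptimum →
          3 / 4 ≤ (BinaryKMeans.goodCenters J B ε zero τ η ζ).prob fun out =>
            ∃ D, out = some D ∧ (BinaryKMeans.cost D J.points : ℝ) ≤ (1 + ε) * J.opt) ∧
        (1 ≤ d → 2 ≤ n →
          ∀ r ∈ (BinaryKMeans.goodCenters J B ε zero τ η ζ).outcomes,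
            (r.steps : ℝ) ≤ A * (n * d * Real.log n ^ k *
              (2 : ℝ) ^ (A * (k ^ 2 / ε ^ 2 * Real.log (k ^ 2 / ε ^ 2) ^ a)))) := by
  -- The most demanding use is `τ ≥ 6400 * k / ε ^ 2`, which follows since `log (k / ε) ≥ 0.69`.
  refine ⟨10000, by norm_num, fun c₁ α hα => ?_⟩
  -- The upper estimates need a constant of at least 1, while `c₁` is arbitrary.
  set c : ℝ := max c₁ 1 with hc
  have hc₁ : c₁ ≤ c := le_max_left _ _
  have hc1 : 1 ≤ c := le_max_right _ _
  have hlog2 : 0 < Real.log 2 := Real.log_pos (by norm_num)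
  -- Division by `log 2` changes the base from `exp 1` to 2; `A ≥ 1` makes the leading factor `A`
  -- harmless.
  set A : ℝ := max 1 (BinaryKMeans.timeConst c α / Real.log 2) with hA
  have hA1 : 1 ≤ A := le_max_left _ _
  refine ⟨A, 2, fun n d k _ _ J B ε zero τ η ζ hε hε' hJ hB ⟨hτ, hτ'⟩ ⟨hη, hη'⟩ ⟨hζ, hζ'⟩ => ?_⟩
  have hkN : 1 ≤ k := NeZero.one_le
  have hk : (1 : ℝ) ≤ k := by exact_mod_cast hkN
  have hε2 : ε ^ 2 ≤ ε := by nlinarith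
  have hlogk : 0.69 ≤ Real.log (k / ε) := by
    have h2 : 2 ≤ k / ε := by rw [le_div_iff₀ hε]; linarith
    linarith [Real.log_two_gt_d9, Real.log_le_log (by norm_num) h2]
  have hτlow : 6400 * (k / ε ^ 2) ≤ τ := by
    refine le_trans ?_ hτ
    have : 0 ≤ k / ε ^ 2 := by positivity
    nlinarith
  have hτ6400 : 6400 / ε ^ 2 ≤ τ := by
    refine le_trans ?_ hτlow
    rw [← mul_div_assoc]
    gcongr
    linarith
  have hτk : 2 * k ≤ τ := by
    have h1 : (k : ℝ) ≤ k / ε ^ 2 := le_div_self (by linarith) (by positivity) (by linarith)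
    have : (2 * k : ℝ) ≤ τ := by linarith
    exact_mod_cast this
  have hτ1 : 1 ≤ τ := by omega
  have hτR : (1 : ℝ) ≤ τ := by exact_mod_cast hτ1
  have hηlow : 512 * (τ * α * k / ε) ≤ η := by
    refine le_trans ?_ hη
    have h1 : τ * α * k / ε ≤ τ * α * k / ε ^ 2 := by gcongr
    have h2 : 0 ≤ τ * α * k / ε := by positivity
    linarith
  have hη1 : 1 ≤ η := by
    have : (0 : ℝ) < η := lt_of_lt_of_le (by positivity) hηlow
    exact_mod_cast this
  have hζlow : 24 / ε ≤ ζ := by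
    refine le_trans ?_ hζ
    rw [mul_one_div]
    gcongr
    norm_num
  have hζ1 : 1 ≤ ζ := by
    have : (0 : ℝ) < ζ := lt_of_lt_of_le (by positivity) hζlow
    exact_mod_cast this
  refine ⟨BinaryKMeans.goodCenters_satisfies hJ B ε zero τ η hζ1,
    fun hfull => BinaryKMeans.goodCenters_prob hJ hα hB hε hε' hfull hτ6400 hτk hηlow hζlow,
    fun hd hn r hr => ?_⟩
  have hsteps := BinaryKMeans.goodCenters_steps_le J B ε zero hd hkN hτ1 hη1 hζ1 r hr
  have hbound := BinaryKMeans.steps_bound (d := d) hc1 hα hε hε' (NeZero.one_le : 1 ≤ n) hkN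
    (hτ'.trans (by gcongr)) (hη'.trans (by gcongr)) (hζ'.trans (by gcongr))
    (BinaryKMeans.length_guesses_le_log hε hε' hn zero)
  have hlogn : 0 ≤ Real.log n := Real.log_natCast_nonneg n
  calc (r.steps : ℝ) ≤ _ := Nat.cast_le.2 hsteps
    _ ≤ _ := hbound
    _ ≤ n * d * Real.log n ^ k *
          (2 : ℝ) ^ (A * (k ^ 2 / ε ^ 2 * Real.log (k ^ 2 / ε ^ 2) ^ 2)) := by
        rw [Real.rpow_def_of_pos (by norm_num)]
        refine mul_le_mul_of_nonneg_left (Real.exp_le_exp.2 ?_) (by positivity)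
        have hK : BinaryKMeans.timeConst c α ≤ Real.log 2 * A := by
          rw [mul_comm, ← div_le_iff₀ hlog2]
          exact le_max_right _ _
        rw [← mul_assoc (Real.log 2)]
        exact mul_le_mul_of_nonneg_right hK (by positivity)
    _ ≤ _ := le_mul_of_one_le_left (by positivity) hA1
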